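/- For $n\ge 1$ and $p\in[0,1]$ let $\mathcal B(n,n,p)$ be the random bipartite graph with parts $A,B$, $|A|=|B|=n$, in which each pair in $A\times B$ is an edge independently with probability $p$, and let $P_{\mathcal B(n,n,p)}$ be the partial order on $A\sqcup B$ in which $x<y$ if and only if $x\in A$, $y\in B$ and $xy$ is an edge. The dimension $\dim P$ of a finite partial order $P$ is the least number of total orders in a realiser of $P$, i.e. in a nonempty set $\mathcal R$ of total orders on the ground set such that $i<_P j$ implies $i<_L j$ for all $L\in\mathcal R$, and such that for all $i,j$ incomparable in $P$ there are $L,L'\in\mathcal R$ with $i<_L j$ and $j<_{L'} i$. For $c>0$ let $\alpha_c$ be the unique positive solution $x$ of $\frac{e^2}{x^2}e^{-cx}=1$. "A.a.s." means with probability tending to $1$ as $n\to\infty$. **Theorem.** Let $p=p_n=c_n/n$, where $(c_n)$ is a sequence of real numbers with $2\le c_n\le \log^2 n$ for all sufficiently large $n$. Then: (a) there is a sequence $\varepsilon_n\to 0$ such that a.a.s. $\dim P_{\mathcal B(n,n,p)}\ge (1-\varepsilon_n)\frac{1}{2\alpha_{c_n}}$; (b) there exist absolute constants $\gamma_1,\gamma_2>0$,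 independent of $n$ and of the sequence $(c_n)$, such that a.a.s. $\gamma_1\, c_n/\log c_n\le \dim P_{\mathcal B(n,n,p)}\le \gamma_2\, c_n\log^2 c_n$. -/

import Mathlib

open Filter Topology MeasureTheory

namespace RandomBipartiteOrder

/-- A finite (nonempty) set `R` of total orders on `V` is a realiser of the partial order `P` if
every relation `i <_P j` holds in all members of `R`, and every pair incomparable in `P` is
ordered in both ways by members of `R`. -/
structure IsRealiser {V : Type*} (P : PartialOrder V) (R : Finset (LinearOrder V)) : Prop where
  nonempty : R.Nonempty
  extends_lt : ∀ i j : V, P.lt i j → ∀ L ∈ R, L.lt i j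
  reverses : ∀ i j : V, ¬ P.le i j → ¬ P.le j i →
    (∃ L ∈ R, L.lt i j) ∧ (∃ L' ∈ R, L'.lt j i)

/-- The dimension of a partial order on a finite set: the size of a minimum realiser. A realiser
always exists, see `exists_isRealiser`. -/
noncomputable def dim {V : Type*} (P : PartialOrder V) : ℕ :=
  sInf {k : ℕ | ∃ R : Finset (LinearOrder V), IsRealiser P R ∧ R.card = k}

/-- The bipartite order on `A ⊔ B`, with `A` (left summand) and `B` (right summand) two disjoint
copies of an `n`-element set, of the bipartite graph with edge set `E ⊆ A × B`:
`x < y` iff `x ∈ A`, `y ∈ B` and `xy` is an edge. -/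
@[reducible]
def bipartiteOrder {n : ℕ} (E : Set (Fin n × Fin n)) : PartialOrder (Fin n ⊕ Fin n) where
  le x y := x = y ∨ ∃ i j : Fin n, (i, j) ∈ E ∧ x = Sum.inl i ∧ y = Sum.inr j
  lt x y := ∃ i j : Fin n, (i, j) ∈ E ∧ x = Sum.inl i ∧ y = Sum.inr j
  lt_iff_le_not_ge := by
    rintro x y
    constructor
    · rintro ⟨i, j, h, rfl, rfl⟩
      exact ⟨Or.inr ⟨i, j, h, rfl, rfl⟩, by simp⟩
    · rintro ⟨rfl | h, h'⟩
      · exact absurd (Or.inl rfl) h'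
      · exact h
  le_refl x := Or.inl rfl
  le_trans := by
    rintro x y z (rfl | ⟨i, j, h, rfl, rfl⟩) (rfl | ⟨i', j', h', h1, rfl⟩)
    · exact Or.inl rfl
    · exact Or.inr ⟨i', j', h', h1, rfl⟩
    · exact Or.inr ⟨i, j, h, rfl, rfl⟩
    · cases h1
  le_antisymm := by
    rintro x y (rfl | ⟨i, j, h, rfl, rfl⟩) h2
    · rfl
    · rcases h2 with h2 | ⟨i', j', h', h1, h2⟩
      · cases h2
      · cases h1

/-- The law of the edge set of the random bipartite graph `B(n, n, p)`: every pair in `A × B` is an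
edge with probability `p`, independently. -/
noncomputable def randomBipartite (n : ℕ) (p : unitInterval) : Measure (Set (Fin n × Fin n)) :=
  ProbabilityTheory.setBernoulli Set.univ p

/-- The event `S n` holds asymptotically almost surely for the random bipartite graphs
`B(n, n, p n)`: its probability tends to `1` as `n → ∞`. -/
def AAS (p : ℕ → unitInterval) (S : (n : ℕ) → Set (Set (Fin n × Fin n))) : Prop :=
  Tendsto (fun n => randomBipartite n (p n) (S n)) atTop (𝓝 1)

/-- `α_c`: the positive solution `x` of `(e² / x²) e^{-c x} = 1`; for `c > 0` it exists and is
unique, see `alpha_spec` and `alpha_unique`. -/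
noncomputable def alpha (c : ℝ) : ℝ :=
  Classical.epsilon fun x : ℝ => 0 < x ∧ Real.exp 2 / x ^ 2 * Real.exp (-(c * x)) = 1

theorem alpha_spec {c : ℝ} (hc : 0 < c) :
    0 < alpha c ∧ Real.exp 2 / alpha c ^ 2 * Real.exp (-(c * alpha c)) = 1 := by
  have key : ∃ x : ℝ, 0 < x ∧ Real.exp 2 / x ^ 2 * Real.exp (-(c * x)) = 1 := by
    have hcont : ContinuousOn (fun x : ℝ => x ^ 2 * Real.exp (c * x)) (Set.Icc 0 (Real.exp 1)) := by
      fun_prop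
    have hmem : Real.exp 2 ∈ Set.Icc ((0 : ℝ) ^ 2 * Real.exp (c * 0))
        (Real.exp 1 ^ 2 * Real.exp (c * Real.exp 1)) := by
      have h1 : Real.exp 1 ^ 2 = Real.exp 2 := by rw [← Real.exp_nat_mul]; norm_num
      have h2 : 1 ≤ Real.exp (c * Real.exp 1) := Real.one_le_exp (by positivity)
      have h3 := Real.exp_pos 2
      rw [h1]
      constructor
      · simpa using h3.le
      · nlinarith
    obtain ⟨x, hx, hfx⟩ := intermediate_value_Icc (Real.exp_pos 1).le hcont hmem
    have hfx' : x ^ 2 * Real.exp (c * x) = Real.exp 2 := hfx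
    have hx0 : x ≠ 0 := by
      rintro rfl
      have := Real.exp_pos 2
      simp at hfx'
      linarith
    refine ⟨x, lt_of_le_of_ne hx.1 (Ne.symm hx0), ?_⟩
    rw [← hfx', Real.exp_neg]
    have := (Real.exp_pos (c * x)).ne'
    field_simp
  exact Classical.epsilon_spec key

theorem alpha_unique {c x : ℝ} (hc : 0 < c) (hx : 0 < x)
    (h : Real.exp 2 / x ^ 2 * Real.exp (-(c * x)) = 1) : x = alpha c := by
  have conv : ∀ y : ℝ, 0 < y → Real.exp 2 / y ^ 2 * Real.exp (-(c * y)) = 1 →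
      y ^ 2 * Real.exp (c * y) = Real.exp 2 := by
    intro y hy h
    rw [Real.exp_neg] at h
    have := (Real.exp_pos (c * y)).ne'
    have h2 : y ^ 2 ≠ 0 := by positivity
    rw [div_mul_eq_mul_div, div_eq_one_iff_eq h2, mul_inv_eq_iff_eq_mul₀ this] at h
    exact h.symm
  have mono : ∀ y z : ℝ, 0 < y → y < z → y ^ 2 * Real.exp (c * y) < z ^ 2 * Real.exp (c * z) := by
    intro y z hy hyz
    have h1 : Real.exp (c * y) < Real.exp (c * z) := Real.exp_lt_exp.2 (by nlinarith)
    have h2 : y ^ 2 < z ^ 2 := by nlinarith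
    exact mul_lt_mul h2 h1.le (Real.exp_pos _) (by positivity)
  obtain ⟨ha, hb⟩ := alpha_spec hc
  have e1 := conv x hx h
  have e2 := conv _ ha hb
  rcases lt_trichotomy x (alpha c) with hl | hl | hl
  · have := mono _ _ hx hl
    linarith
  · exact hl
  · have := mono _ _ ha hl
    linarith

theorem exists_linearOrder_extend {V : Type*} (r : V → V → Prop) [IsPartialOrder V r] :
    ∃ L : LinearOrder V, ∀ a b, r a b → a ≠ b → L.lt a b := by
  obtain ⟨s, hs, hrs⟩ := extend_partialOrder r
  let L : LinearOrder V :=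
    { le := s
      lt := fun a b => s a b ∧ ¬ s b a
      lt_iff_le_not_ge := fun _ _ => Iff.rfl
      le_refl := hs.refl
      le_trans := hs.trans
      le_antisymm := hs.antisymm
      le_total := hs.total
      toDecidableLE := Classical.decRel s
      toDecidableEq := Classical.decEq V
      toDecidableLT := Classical.decRel _
      min := fun a b => @ite _ (s a b) (Classical.dec _) a b
      max := fun a b => @ite _ (s a b) (Classical.dec _) b a
      min_def := fun _ _ => rfl
      max_def := fun _ _ => rfl
      compare := fun a b => @compareOfLessAndEq V a b ⟨fun a b => s a b ∧ ¬ s b a⟩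
        (Classical.dec _) (Classical.decEq V)
      compare_eq_compareOfLessAndEq := fun _ _ => rfl }
  exact ⟨L, fun a b h hne => ⟨hrs a b h, fun h' => hne (hs.antisymm _ _ (hrs a b h) h')⟩⟩

theorem exists_linearOrder_lt {V : Type*} (P : PartialOrder V) (i j : V) (hji : ¬ P.le j i) :
    ∃ L : LinearOrder V, (∀ a b, P.lt a b → L.lt a b) ∧ (i ≠ j → L.lt i j) := by
  classical
  let r : V → V → Prop := fun a b => P.le a b ∨ (P.le a i ∧ P.le j b)
  have hr : IsPartialOrder V r :=
    { refl := fun a => Or.inl (P.le_refl a)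
      trans := by
        rintro a b c (h | ⟨h1, h2⟩) (h' | ⟨h1', h2'⟩)
        · exact Or.inl (P.le_trans _ _ _ h h')
        · exact Or.inr ⟨P.le_trans _ _ _ h h1', h2'⟩
        · exact Or.inr ⟨h1, P.le_trans _ _ _ h2 h'⟩
        · exact Or.inr ⟨h1, h2'⟩
      antisymm := by
        rintro a b (h | ⟨h1, h2⟩) (h' | ⟨h1', h2'⟩)
        · exact P.le_antisymm _ _ h h'
        · exact (hji (P.le_trans _ _ _ h2' (P.le_trans _ _ _ h h1'))).elim
        · exact (hji (P.le_trans _ _ _ h2 (P.le_trans _ _ _ h' h1))).elim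
        · exact (hji (P.le_trans _ _ _ h2 h1')).elim }
  obtain ⟨L, hlt⟩ := exists_linearOrder_extend r
  refine ⟨L, fun a b h => hlt a b (Or.inl (P.lt_iff_le_not_ge a b |>.1 h).1) ?_,
    fun hne => hlt i j (Or.inr ⟨P.le_refl i, P.le_refl j⟩) hne⟩
  rintro rfl
  exact ((P.lt_iff_le_not_ge a a).1 h).2 (P.le_refl a)

theorem exists_isRealiser {V : Type*} [Finite V] (P : PartialOrder V) :
    ∃ R : Finset (LinearOrder V), IsRealiser P R := by
  classical
  have _ := Fintype.ofFinite V
  have h0 : ∃ L : LinearOrder V, ∀ a b, P.lt a b → L.lt a b := by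
    have _ : IsPartialOrder V P.le :=
      { refl := P.le_refl, trans := P.le_trans, antisymm := P.le_antisymm }
    obtain ⟨L, hL⟩ := exists_linearOrder_extend P.le
    refine ⟨L, fun a b h => hL a b ((P.lt_iff_le_not_ge a b).1 h).1 ?_⟩
    rintro rfl
    exact ((P.lt_iff_le_not_ge a a).1 h).2 (P.le_refl a)
  obtain ⟨L0, hL0⟩ := h0
  have hex : ∀ q : V × V, ∃ L : LinearOrder V, (∀ a b, P.lt a b → L.lt a b) ∧
      (¬ P.le q.2 q.1 → q.1 ≠ q.2 → L.lt q.1 q.2) := by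
    intro q
    by_cases h : P.le q.2 q.1
    · exact ⟨L0, hL0, fun h' => absurd h h'⟩
    · obtain ⟨L, h1, h2⟩ := exists_linearOrder_lt P q.1 q.2 h
      exact ⟨L, h1, fun _ => h2⟩
  choose f hf1 hf2 using hex
  refine ⟨insert L0 (Finset.univ.image f), Finset.insert_nonempty _ _, ?_, ?_⟩
  · intro i j hij L hL
    rcases Finset.mem_insert.1 hL with rfl | hL
    · exact hL0 i j hij
    · obtain ⟨q, -, rfl⟩ := Finset.mem_image.1 hL
      exact hf1 q i j hij
  · intro i j hij hji
    have hne : i ≠ j := by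
      rintro rfl
      exact hij (P.le_refl i)
    exact ⟨⟨f (i, j), by simp, hf2 (i, j) hji hne⟩, ⟨f (j, i), by simp, hf2 (j, i) hij hne.symm⟩⟩

end RandomBipartiteOrder

namespace RandomBipartiteOrder

/-! Lower bound. Call a pair (a, b) reversed by a linear extension if b lies below a. If every s × s
box contains an edge, at most s vertices a have s or more reversed partners, since more than s of
them would form an empty box with the partners of the lowest one. Hence one extension reverses at
most 2sn pairs (`card_reversed_le`). A realiser reverses all n² − |E| non-edges, so the dimension is
at least (n² − |E|)/(2sn). The expected number of empty s × s boxes with s = xn is at most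
((e²/x²)e^{-cx})^s, so s may be taken just above α_c n, while |E| = o(n²).

Upper bound. Two orders with A below B handle everything except the reversal of non-edges. For that,
blocks of A are lifted to the top and ordered by a fixed ω or by its reverse; the non-edge ab is
reversed if a lies in a block whose elements of N(b) are all on one side of a (`Separates`). For
most b, of degree at most d = O(c), a random colouring of A by polynomially many (in c) colours is
injective on N(b), and O(c log c) random sets of colours, each colour taken with probability
1/(d+1), isolate every colour from the others seen by b (`exists_mostly_separates`). The exceptional
b number at most n/C^15 with C = ⌈c⌉, and such a small set spans so few edges with any X ⊆ A that a
bounded number of blocks suffices (`IsSparse.exists_separates`). -/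

/-! ### Realisers built from keys and blocks. -/

/-- The neighbourhood in `A` of a vertex `b ∈ B`. -/
noncomputable def nbrs {n : ℕ} (E : Set (Fin n × Fin n)) (b : Fin n) : Finset (Fin n) :=
  open Classical in Finset.univ.filter fun a => (a, b) ∈ E

theorem mem_nbrs {n : ℕ} {E : Set (Fin n × Fin n)} {a b : Fin n} :
    a ∈ nbrs E b ↔ (a, b) ∈ E := by
  simp [nbrs]

theorem dim_le_card {V : Type*} {P : PartialOrder V} {R : Finset (LinearOrder V)}
    (h : IsRealiser P R) : dim P ≤ R.card :=
  Nat.sInf_le ⟨R, h, rfl⟩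

theorem exists_realiser_card_eq_dim {V : Type*} [Finite V] (P : PartialOrder V) :
    ∃ R : Finset (LinearOrder V), IsRealiser P R ∧ R.card = dim P := by
  obtain ⟨R, hR⟩ := exists_isRealiser P
  exact Nat.sInf_mem (s := {k : ℕ | ∃ R : Finset (LinearOrder V), IsRealiser P R ∧ R.card = k})
    ⟨_, R, hR, rfl⟩

/-- The order on `A ⊔ B` in which `A` is ordered by `κ` and every `b ∈ B` is placed as low as
possible. -/
theorem exists_linearOrder_of_key {n : ℕ} (E : Set (Fin n × Fin n)) (κ : Fin n → ℕ) :
    ∃ L : LinearOrder (Fin n ⊕ Fin n), (∀ x y, (bipartiteOrder E).lt x y → L.lt x y) ∧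
      ∀ a b, (∀ a' ∈ nbrs E b, κ a' < κ a) → L.lt (Sum.inr b) (Sum.inl a) := by
  -- Elements of A get even first coordinates and elements of B odd ones, so b sits immediately
  -- above its highest neighbour, or at the bottom if it has none. The second coordinate only breaks
  -- ties within a side.
  let key : Fin n ⊕ Fin n → ℕ ×ₗ ℕ := Sum.elim (fun a => toLex (2 * (κ a + 1), (a : ℕ)))
    (fun b => toLex (2 * (nbrs E b).sup (fun a => κ a + 1) + 1, (b : ℕ)))
  have hkey : Function.Injective key := by
    rintro (a | b) (a' | b') h
    · simp only [key, Sum.elim_inl, toLex_inj, Prod.mk.injEq] at h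
      rw [Fin.ext h.2]
    · simp only [key, Sum.elim_inl, Sum.elim_inr, toLex_inj, Prod.mk.injEq] at h
      omega
    · simp only [key, Sum.elim_inl, Sum.elim_inr, toLex_inj, Prod.mk.injEq] at h
      omega
    · simp only [key, Sum.elim_inr, toLex_inj, Prod.mk.injEq] at h
      rw [Fin.ext h.2]
  refine ⟨LinearOrder.lift' key hkey, ?_, ?_⟩
  · rintro x y ⟨a, b, hE, rfl, rfl⟩
    change key _ < key _
    have : κ a + 1 ≤ (nbrs E b).sup (fun a => κ a + 1) :=
      Finset.le_sup (f := fun a => κ a + 1) (mem_nbrs.2 hE)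
    simp only [key, Sum.elim_inl, Sum.elim_inr, Prod.Lex.toLex_lt_toLex]
    left
    omega
  · intro a b h
    change key _ < key _
    have : (nbrs E b).sup (fun a => κ a + 1) ≤ κ a := Finset.sup_le fun a' ha' => h a' ha'
    simp only [key, Sum.elim_inl, Sum.elim_inr, Prod.Lex.toLex_lt_toLex]
    left
    omega

/-- Used with the identity and the reversal for `e`: these two orders reverse all pairs inside A and
inside B, and put a below b for every non-edge. -/
theorem exists_linearOrder_parts {n : ℕ} (E : Set (Fin n × Fin n)) (e : Fin n → ℕ)
    (he : Function.Injective e) (hn : ∀ a, e a < n) :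
    ∃ L : LinearOrder (Fin n ⊕ Fin n), (∀ x y, (bipartiteOrder E).lt x y → L.lt x y) ∧
      (∀ a b, L.lt (Sum.inl a) (Sum.inr b)) ∧
      (∀ a a', e a < e a' → L.lt (Sum.inl a) (Sum.inl a')) ∧
      (∀ b b', e b < e b' → L.lt (Sum.inr b) (Sum.inr b')) := by
  let key : Fin n ⊕ Fin n → ℕ := Sum.elim e (fun b => n + e b)
  have hkey : Function.Injective key := by
    rintro (a | b) (a' | b') h
    · simp only [key, Sum.elim_inl] at h
      rw [he h]
    · simp only [key, Sum.elim_inl, Sum.elim_inr] at h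
      have := hn a
      omega
    · simp only [key, Sum.elim_inl, Sum.elim_inr] at h
      have := hn a'
      omega
    · simp only [key, Sum.elim_inr, add_right_inj] at h
      rw [he h]
  have hab : ∀ a b, key (Sum.inl a) < key (Sum.inr b) := by
    intro a b
    have := hn a
    simp only [key, Sum.elim_inl, Sum.elim_inr]
    omega
  refine ⟨LinearOrder.lift' key hkey, ?_, hab, fun a a' h => h, fun b b' h => ?_⟩
  · rintro x y ⟨a, b, -, rfl, rfl⟩
    exact hab a b
  · change key _ < key _
    simpa [key] using h

/-- A family of keys on `A` such that every non-edge `ab` is reversed by one of the orders it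
induces bounds the dimension. -/
theorem dim_le_of_keys {n : ℕ} (E : Set (Fin n × Fin n)) {ι : Type*} [Fintype ι]
    (κ : ι → Fin n → ℕ)
    (h : ∀ b, ∀ a ∉ nbrs E b, ∃ i, ∀ a' ∈ nbrs E b, κ i a' < κ i a) :
    dim (bipartiteOrder E) ≤ Fintype.card ι + 2 := by
  classical
  choose L hL1 hL2 using fun i => exists_linearOrder_of_key E (κ i)
  obtain ⟨F, hF1, hF2, hF3, hF4⟩ := exists_linearOrder_parts E (fun a => (a : ℕ))
    Fin.val_injective (fun a => a.2)
  obtain ⟨G, hG1, hG2, hG3, hG4⟩ := exists_linearOrder_parts E (fun a => (a.rev : ℕ))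
    (Fin.val_injective.comp Fin.rev_injective) (fun a => a.rev.2)
  have hR : IsRealiser (bipartiteOrder E) (insert F (insert G (Finset.univ.image L))) := by
    refine ⟨Finset.insert_nonempty _ _, ?_, ?_⟩
    · intro x y hxy M hM
      simp only [Finset.mem_insert, Finset.mem_image, Finset.mem_univ, true_and] at hM
      rcases hM with rfl | rfl | ⟨i, rfl⟩
      exacts [hF1 x y hxy, hG1 x y hxy, hL1 i x y hxy]
    · have mF : F ∈ insert F (insert G (Finset.univ.image L)) := by simp
      have mG : G ∈ insert F (insert G (Finset.univ.image L)) := by simp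
      have mL : ∀ i, L i ∈ insert F (insert G (Finset.univ.image L)) := by simp
      have key : ∀ a b, (a, b) ∉ E → ∃ i, (L i).lt (Sum.inr b) (Sum.inl a) := by
        intro a b hab
        obtain ⟨i, hi⟩ := h b a (by rwa [mem_nbrs])
        exact ⟨i, hL2 i a b hi⟩
      rintro (a | b) (a' | b') hxy hyx
      · have hne : a ≠ a' := by rintro rfl; exact hxy (Or.inl rfl)
        rcases lt_or_gt_of_ne hne with hlt | hlt
        · exact ⟨⟨F, mF, hF3 _ _ hlt⟩, ⟨G, mG, hG3 _ _ (Fin.rev_lt_rev.2 hlt)⟩⟩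
        · exact ⟨⟨G, mG, hG3 _ _ (Fin.rev_lt_rev.2 hlt)⟩, ⟨F, mF, hF3 _ _ hlt⟩⟩
      · obtain ⟨i, hi⟩ := key a b' (fun hE => hxy (Or.inr ⟨a, b', hE, rfl, rfl⟩))
        exact ⟨⟨F, mF, hF2 _ _⟩, ⟨L i, mL i, hi⟩⟩
      · obtain ⟨i, hi⟩ := key a' b (fun hE => hyx (Or.inr ⟨a', b, hE, rfl, rfl⟩))
        exact ⟨⟨L i, mL i, hi⟩, ⟨F, mF, hF2 _ _⟩⟩
      · have hne : b ≠ b' := by rintro rfl; exact hxy (Or.inl rfl)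
        rcases lt_or_gt_of_ne hne with hlt | hlt
        · exact ⟨⟨F, mF, hF4 _ _ hlt⟩, ⟨G, mG, hG4 _ _ (Fin.rev_lt_rev.2 hlt)⟩⟩
        · exact ⟨⟨G, mG, hG4 _ _ (Fin.rev_lt_rev.2 hlt)⟩, ⟨F, mF, hF4 _ _ hlt⟩⟩
  calc dim (bipartiteOrder E) ≤ _ := dim_le_card hR
    _ ≤ (Finset.univ.image L).card + 1 + 1 :=
      (Finset.card_insert_le _ _).trans (Nat.succ_le_succ (Finset.card_insert_le _ _))
    _ ≤ Fintype.card ι + 2 := by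
      have := Finset.card_image_le (s := (Finset.univ : Finset ι)) (f := L)
      rw [Finset.card_univ] at this
      omega

/-- The blocks `T i` of `A`, each of them put on top of `A` and ordered by `ω` or by its reverse,
separate every `b ∈ S` from all its non-neighbours `a`. -/
def Separates {A B ι : Type*} (N : B → Finset A) (S : Set B) (T : ι → Set A) (ω : A → ℕ) : Prop :=
  ∀ b ∈ S, ∀ a ∉ N b, ∃ i, a ∈ T i ∧
    ((∀ a' ∈ N b, a' ∈ T i → ω a' < ω a) ∨ (∀ a' ∈ N b, a' ∈ T i → ω a < ω a'))

/-- Each block gives two keys, zero off the block and increasing or decreasing in `ω` on it. The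
bound M keeps the truncated subtraction M − ω strictly decreasing. -/
theorem Separates.exists_keys {A B ι : Type*} [Finite A] {N : B → Finset A} {S : Set B}
    {T : ι → Set A} {ω : A → ℕ} (h : Separates N S T ω) :
    ∃ κ : ι × Bool → A → ℕ, ∀ b ∈ S, ∀ a ∉ N b, ∃ i, ∀ a' ∈ N b, κ i a' < κ i a := by
  classical
  obtain ⟨M, hM⟩ : ∃ M, ∀ a, ω a ≤ M := by
    obtain ⟨M, hM⟩ := (Set.finite_range ω).bddAbove
    exact ⟨M, fun a => hM ⟨a, rfl⟩⟩
  refine ⟨fun i a => if a ∈ T i.1 then 1 + (if i.2 then ω a else M - ω a) else 0, ?_⟩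
  intro b hb a ha
  obtain ⟨i, hi, h1 | h1⟩ := h b hb a ha
  · refine ⟨(i, true), fun a' ha' => ?_⟩
    by_cases hT : a' ∈ T i
    · simpa [hT, hi] using h1 a' ha' hT
    · simp [hT, hi]
  · refine ⟨(i, false), fun a' ha' => ?_⟩
    by_cases hT : a' ∈ T i
    · have := h1 a' ha' hT
      have := hM a'
      simp only [hT, hi, if_true, Bool.false_eq_true, if_false]
      omega
    · simp [hT, hi]

theorem dim_le_of_separates {n : ℕ} (E : Set (Fin n × Fin n)) {ι₁ ι₂ : Type*} [Fintype ι₁]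
    [Fintype ι₂] {S₁ S₂ : Set (Fin n)} {T₁ : ι₁ → Set (Fin n)} {T₂ : ι₂ → Set (Fin n)}
    {ω₁ ω₂ : Fin n → ℕ} (h₁ : Separates (nbrs E) S₁ T₁ ω₁) (h₂ : Separates (nbrs E) S₂ T₂ ω₂)
    (hS : ∀ b, b ∈ S₁ ∨ b ∈ S₂) :
    dim (bipartiteOrder E) ≤ 2 * Fintype.card ι₁ + 2 * Fintype.card ι₂ + 2 := by
  obtain ⟨κ₁, hκ₁⟩ := h₁.exists_keys
  obtain ⟨κ₂, hκ₂⟩ := h₂.exists_keys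
  have := dim_le_of_keys E (Sum.elim κ₁ κ₂) (by
    intro b a ha
    rcases hS b with hb | hb
    · obtain ⟨i, hi⟩ := hκ₁ b hb a ha
      exact ⟨Sum.inl i, hi⟩
    · obtain ⟨i, hi⟩ := hκ₂ b hb a ha
      exact ⟨Sum.inr i, hi⟩)
  simp only [Fintype.card_sum, Fintype.card_prod, Fintype.card_bool] at this
  omega

/-! ### Counting reversed pairs. -/

/-- If no `s × s` box is free of edges, then a linear extension reverses at most `2sn` pairs. -/
theorem card_reversed_le {n s : ℕ} {E : Set (Fin n × Fin n)}
    (hbox : ∀ X Y : Finset (Fin n), X.card = s → Y.card = s → ∃ a ∈ X, ∃ b ∈ Y, (a, b) ∈ E)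
    (L : LinearOrder (Fin n ⊕ Fin n)) (hL : ∀ x y, (bipartiteOrder E).lt x y → L.lt x y)
    (F : Finset (Fin n × Fin n)) (hF : ∀ q ∈ F, L.lt (Sum.inr q.2) (Sum.inl q.1)) :
    F.card ≤ 2 * s * n := by
  classical
  let row : Fin n → Finset (Fin n) := fun a =>
    Finset.univ.filter fun b => L.lt (Sum.inr b) (Sum.inl a)
  let X : Finset (Fin n) := Finset.univ.filter fun a => s ≤ (row a).card
  have hX : X.card ≤ s := by
    by_contra! hlt
    have hne : X.Nonempty := Finset.card_pos.1 (by omega)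
    -- Everything below the lowest heavy a₀ is below all of X, so X × row a₀ contains no edge; both
    -- sides have at least s elements.
    obtain ⟨a₀, ha₀, hmin⟩ : ∃ a₀ ∈ X, ∀ a ∈ X, L.le (Sum.inl a₀) (Sum.inl a) :=
      @Finset.exists_min_image _ _ L X (fun a => (Sum.inl a : Fin n ⊕ Fin n)) hne
    obtain ⟨X', hX', hcX⟩ := Finset.exists_subset_card_eq hlt.le
    obtain ⟨Y', hY', hcY⟩ := Finset.exists_subset_card_eq (Finset.mem_filter.1 ha₀).2
    obtain ⟨a, ha, b, hb, hab⟩ := hbox X' Y' hcX hcY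
    have h1 : L.lt (Sum.inl a) (Sum.inr b) := hL _ _ ⟨a, b, hab, rfl, rfl⟩
    have h2 : L.lt (Sum.inr b) (Sum.inl a₀) := (Finset.mem_filter.1 (hY' hb)).2
    exact ((L.lt_iff_le_not_ge _ _).1 h1).2
      (L.le_trans _ _ _ ((L.lt_iff_le_not_ge _ _).1 h2).1 (hmin a (hX' ha)))
  have hfib : ∀ a, (F.filter fun q => q.1 = a).card ≤ (if a ∈ X then n else 0) + s := by
    intro a
    have h1 : (F.filter fun q => q.1 = a).card ≤ (row a).card := by
      refine Finset.card_le_card_of_injOn Prod.snd ?_ ?_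
      · intro q hq
        obtain ⟨hq1, rfl⟩ := Finset.mem_filter.1 hq
        exact Finset.mem_filter.2 ⟨Finset.mem_univ _, hF q hq1⟩
      · intro q hq q' hq' h
        exact Prod.ext ((Finset.mem_filter.1 hq).2.trans (Finset.mem_filter.1 hq').2.symm) h
    split_ifs with ha
    · have := Finset.card_le_univ (row a)
      rw [Fintype.card_fin] at this
      omega
    · have : ¬ s ≤ (row a).card := fun h => ha (Finset.mem_filter.2 ⟨Finset.mem_univ _, h⟩)
      omega
  calc F.card = ∑ a : Fin n, (F.filter fun q => q.1 = a).card :=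
        Finset.card_eq_sum_card_fiberwise fun _ _ => Finset.mem_univ _
    _ ≤ ∑ a : Fin n, ((if a ∈ X then n else 0) + s) := Finset.sum_le_sum fun a _ => hfib a
    _ = X.card * n + n * s := by simp [Finset.sum_add_distrib, Finset.sum_ite_mem]
    _ ≤ s * n + n * s := by gcongr
    _ = 2 * s * n := by ring

/-- Each of the n² pairs is an edge or is reversed by some member of a minimum realiser. -/
theorem sq_le_ncard_add_dim_mul {n s : ℕ} {E : Set (Fin n × Fin n)}
    (hbox : ∀ X Y : Finset (Fin n), X.card = s → Y.card = s → ∃ a ∈ X, ∃ b ∈ Y, (a, b) ∈ E) :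
    n ^ 2 ≤ E.ncard + dim (bipartiteOrder E) * (2 * s * n) := by
  classical
  obtain ⟨R, hR, hcard⟩ := exists_realiser_card_eq_dim (bipartiteOrder E)
  let F : LinearOrder (Fin n ⊕ Fin n) → Finset (Fin n × Fin n) := fun L =>
    Finset.univ.filter fun q => L.lt (Sum.inr q.2) (Sum.inl q.1)
  have hcover : (Finset.univ : Finset (Fin n × Fin n)) ⊆ E.toFinset ∪ R.biUnion F := by
    rintro ⟨a, b⟩ -
    by_cases hab : (a, b) ∈ E
    · simp [hab]
    · obtain ⟨-, L, hL, hlt⟩ := hR.reverses (Sum.inl a) (Sum.inr b) (by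
        rintro (h | ⟨i, j, hE, h1, h2⟩)
        · cases h
        · cases h1; cases h2; exact hab hE) (by
        rintro (h | ⟨i, j, hE, h1, h2⟩)
        · cases h
        · cases h1)
      exact Finset.mem_union_right _ (Finset.mem_biUnion.2 ⟨L, hL, by simpa [F] using hlt⟩)
  calc n ^ 2 = (Finset.univ : Finset (Fin n × Fin n)).card := by simp [sq]
    _ ≤ E.toFinset.card + (R.biUnion F).card :=
      (Finset.card_le_card hcover).trans (Finset.card_union_le _ _)
    _ ≤ E.ncard + R.card * (2 * s * n) := by
      rw [Set.ncard_eq_toFinset_card']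
      gcongr
      refine Finset.card_biUnion_le_card_mul _ _ _ fun L hL => ?_
      exact card_reversed_le hbox L (fun x y h => hR.extends_lt x y h L hL) _
        (fun q hq => (Finset.mem_filter.1 hq).2)
    _ = _ := by rw [hcard]

/-! ### Separation in sparse graphs with boundedly many blocks. -/

/-- A b that is good for S gets the top rank and is removed; then one recurses. The vertices of rank
at most ρ b are exactly those still present when b is removed. -/
theorem exists_elimination_rank {B : Type*} [DecidableEq B] (P : B → Finset B → Prop)
    (S : Finset B) (h : ∀ Y ⊆ S, Y.Nonempty → ∃ b ∈ Y, P b Y) :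
    ∃ ρ : B → ℕ, Set.InjOn ρ S ∧ ∀ b ∈ S, P b (S.filter fun b' => ρ b' ≤ ρ b) := by
  induction S using Finset.strongInduction with
  | H S ih =>
    rcases S.eq_empty_or_nonempty with rfl | hne
    · exact ⟨fun _ => 0, by simp, by simp⟩
    obtain ⟨b, hb, hP⟩ := h S subset_rfl hne
    obtain ⟨ρ, hinj, hρ⟩ := ih (S.erase b) (Finset.erase_ssubset hb)
      (fun Y hY => h Y (hY.trans (Finset.erase_subset _ _)))
    let M := (S.erase b).sup ρ + 1
    have hM : ∀ x ∈ S, x ≠ b → ρ x < M := fun x hx hxb =>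
      Nat.lt_succ_of_le (Finset.le_sup (f := ρ) (Finset.mem_erase.2 ⟨hxb, hx⟩))
    refine ⟨fun x => if x = b then M else ρ x, ?_, ?_⟩
    · intro x hx y hy hxy
      by_cases hxb : x = b <;> by_cases hyb : y = b
      · rw [hxb, hyb]
      · have := hM y hy hyb
        simp [hxb, hyb] at hxy
        omega
      · have := hM x hx hxb
        simp [hxb, hyb] at hxy
        omega
      · simp only [hxb, hyb, if_false] at hxy
        exact hinj (Finset.mem_coe.2 (Finset.mem_erase.2 ⟨hxb, hx⟩))
          (Finset.mem_coe.2 (Finset.mem_erase.2 ⟨hyb, hy⟩)) hxy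
    · intro x hx
      by_cases hxb : x = b
      · subst hxb
        convert hP using 1
        refine Finset.filter_true_of_mem fun y hy => ?_
        by_cases hyb : y = x
        · simp [hyb]
        · simpa [hyb] using (hM y hy hyb).le
      · convert hρ x (Finset.mem_erase.2 ⟨hxb, hx⟩) using 1
        ext y
        by_cases hyb : y = b
        · have := hM x hx hxb
          simp [hyb, hxb, this]
        · simp [hyb, hxb]

/-- Greedy colouring: a vertex with at most d conflicts is coloured last. -/
theorem exists_coloring_of_degenerate {V : Type*} [DecidableEq V] (R : V → V → Prop)
    [DecidableRel R] (hsymm : ∀ u v, R u v → R v u) (d : ℕ) (S : Finset V)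
    (h : ∀ Y ⊆ S, Y.Nonempty → ∃ b ∈ Y, (Y.filter fun b' => b' ≠ b ∧ R b b').card ≤ d) :
    ∃ f : V → Fin (d + 1), ∀ u ∈ S, ∀ v ∈ S, u ≠ v → R u v → f u ≠ f v := by
  induction S using Finset.strongInduction with
  | H S ih =>
    rcases S.eq_empty_or_nonempty with rfl | hne
    · exact ⟨fun _ => 0, by simp⟩
    obtain ⟨b, hb, hd⟩ := h S subset_rfl hne
    obtain ⟨f, hf⟩ := ih (S.erase b) (Finset.erase_ssubset hb)
      (fun Y hY => h Y (hY.trans (Finset.erase_subset _ _)))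
    obtain ⟨c, hc⟩ : ∃ c : Fin (d + 1),
        c ∉ (S.filter fun b' => b' ≠ b ∧ R b b').image f := by
      by_contra! hall
      have h1 : (Finset.univ : Finset (Fin (d + 1))).card ≤ _ :=
        Finset.card_le_card fun c _ => hall c
      have h2 := Finset.card_image_le (s := S.filter fun b' => b' ≠ b ∧ R b b') (f := f)
      rw [Finset.card_fin] at h1
      omega
    have hc' : ∀ v ∈ S, v ≠ b → R b v → f v ≠ c := fun v hv hvb hR hfc =>
      hc (Finset.mem_image.2 ⟨v, Finset.mem_filter.2 ⟨hv, hvb, hR⟩, hfc⟩)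
    refine ⟨fun x => if x = b then c else f x, ?_⟩
    intro u hu v hv huv hR
    by_cases hub : u = b
    · have hvb : v ≠ b := fun h => huv (hub.trans h.symm)
      subst hub
      simpa [hvb] using (hc' v hv hvb hR).symm
    · by_cases hvb : v = b
      · subst hvb
        simpa [hub] using hc' u hu hub (hsymm _ _ hR)
      · simpa [hub, hvb] using hf u (Finset.mem_erase.2 ⟨hub, hu⟩) v
          (Finset.mem_erase.2 ⟨hvb, hv⟩) huv hR

/-- Every set of vertices `Y ⊆ S` spans few edges with every `X ⊆ A`. -/
def IsSparse {A B : Type*} [DecidableEq A] (N : B → Finset A) (S : Finset B) : Prop :=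
  ∀ X : Finset A, ∀ Y ⊆ S, 2 * ∑ b ∈ Y, (N b ∩ X).card ≤ 3 * (X.card + Y.card)

section Sparse

variable {A B : Type*} [Fintype A] [DecidableEq A]

/-- Double counting. Let T be the set of vertices with at least two neighbours in Y. If each b ∈ Y
had 7 shared neighbours, the number e of edges between T and Y would satisfy e ≥ 7|Y| and e ≥ 2|T|,
so sparsity would give 2e ≤ (3/2 + 3/7)e < 2e. -/
theorem IsSparse.exists_few_shared [DecidableEq B] {N : B → Finset A} {S : Finset B} (h : IsSparse N S)
    {Y : Finset B} (hY : Y ⊆ S) (hne : Y.Nonempty) :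
    ∃ b ∈ Y, ((N b).filter fun a => ∃ b' ∈ Y, b' ≠ b ∧ a ∈ N b').card ≤ 6 := by
  by_contra! hlt
  let T : Finset A := Finset.univ.filter fun a => 2 ≤ (Y.filter fun b => a ∈ N b).card
  have hsub : ∀ b ∈ Y, ((N b).filter fun a => ∃ b' ∈ Y, b' ≠ b ∧ a ∈ N b') ⊆ N b ∩ T := by
    intro b hb a ha
    obtain ⟨ha1, b', hb', hne, ha2⟩ := Finset.mem_filter.1 ha
    refine Finset.mem_inter.2 ⟨ha1, Finset.mem_filter.2 ⟨Finset.mem_univ _, ?_⟩⟩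
    exact Finset.one_lt_card.2 ⟨b, Finset.mem_filter.2 ⟨hb, ha1⟩, b',
      Finset.mem_filter.2 ⟨hb', ha2⟩, hne.symm⟩
  have h7 : 7 * Y.card ≤ ∑ b ∈ Y, (N b ∩ T).card := by
    rw [mul_comm, ← smul_eq_mul, ← Finset.sum_const]
    exact Finset.sum_le_sum fun b hb => (hlt b hb).trans_le (Finset.card_le_card (hsub b hb))
  have h2 : 2 * T.card ≤ ∑ b ∈ Y, (N b ∩ T).card := by
    have : ∑ b ∈ Y, (N b ∩ T).card = ∑ a ∈ T, (Y.filter fun b => a ∈ N b).card := by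
      have := Finset.sum_card_bipartiteAbove_eq_sum_card_bipartiteBelow (s := Y) (t := T)
        (fun b a => a ∈ N b)
      simp only [Finset.bipartiteAbove, Finset.bipartiteBelow] at this
      rw [← this]
      refine Finset.sum_congr rfl fun b _ => ?_
      congr 1
      ext a
      simp [and_comm]
    rw [this, mul_comm, ← smul_eq_mul, ← Finset.sum_const]
    exact Finset.sum_le_sum fun a ha => (Finset.mem_filter.1 ha).2
  have := h T Y hY
  have := hne.card_pos
  omega

/-- The graph joining two vertices of a common `O b` is 108-degenerate. If X had minimum degree at
least 109, the number e of incidences of X with the sets `O b` meeting X at least twice would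
satisfy 109|X| ≤ 6e and 2|Y| ≤ e, so 2e ≤ 3(|X| + |Y|) < 2e. The constant is not optimised. -/
theorem IsSparse.exists_rainbow {N : B → Finset A} {S : Finset B} (h : IsSparse N S)
    (O : B → Finset A) (hO : ∀ b, O b ⊆ N b) (hO6 : ∀ b ∈ S, (O b).card ≤ 6) :
    ∃ ψ : A → Fin 109, ∀ b ∈ S, Set.InjOn ψ (O b) := by
  let R : A → A → Prop := fun a a' => ∃ b ∈ S, a ∈ O b ∧ a' ∈ O b
  obtain ⟨ψ, hψ⟩ := exists_coloring_of_degenerate R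
    (fun u v ⟨b, hb, h1, h2⟩ => ⟨b, hb, h2, h1⟩) 108 Finset.univ (by
    intro X _ hne
    by_contra! hlt
    let Y : Finset B := S.filter fun b => 2 ≤ (O b ∩ X).card
    have hY := h X Y (Finset.filter_subset _ _)
    have hle : ∑ b ∈ Y, (O b ∩ X).card ≤ ∑ b ∈ Y, (N b ∩ X).card :=
      Finset.sum_le_sum fun b _ =>
        Finset.card_le_card (Finset.inter_subset_inter_right (hO b))
    have h2 : 2 * Y.card ≤ ∑ b ∈ Y, (O b ∩ X).card := by
      rw [mul_comm, ← smul_eq_mul, ← Finset.sum_const]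
      exact Finset.sum_le_sum fun b hb => (Finset.mem_filter.1 hb).2
    have hnb : ∀ x ∈ X, (X.filter fun x' => x' ≠ x ∧ R x x').card ≤
        (Y.filter fun b => x ∈ O b).card * 6 := by
      intro x hx
      refine (Finset.card_le_card ?_).trans
        (Finset.card_biUnion_le_card_mul (Y.filter fun b => x ∈ O b) O 6 fun b hb =>
          hO6 b (Finset.mem_filter.1 (Finset.mem_filter.1 hb).1).1)
      intro x' hx'
      obtain ⟨hx'X, hne', b, hb, h1, h2⟩ := Finset.mem_filter.1 hx'
      refine Finset.mem_biUnion.2 ⟨b, Finset.mem_filter.2 ⟨Finset.mem_filter.2 ⟨hb, ?_⟩, h1⟩, h2⟩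
      exact Finset.one_lt_card.2 ⟨x', Finset.mem_inter.2 ⟨h2, hx'X⟩, x,
        Finset.mem_inter.2 ⟨h1, hx⟩, hne'⟩
    have hsum : 109 * X.card ≤ (∑ b ∈ Y, (O b ∩ X).card) * 6 := by
      have hdc : ∑ b ∈ Y, (O b ∩ X).card = ∑ x ∈ X, (Y.filter fun b => x ∈ O b).card := by
        have := Finset.sum_card_bipartiteAbove_eq_sum_card_bipartiteBelow (s := Y) (t := X)
          (fun b a => a ∈ O b)
        simp only [Finset.bipartiteAbove, Finset.bipartiteBelow] at this
        rw [← this]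
        refine Finset.sum_congr rfl fun b _ => ?_
        congr 1
        ext a
        simp [and_comm]
      rw [hdc, Finset.sum_mul, mul_comm, ← smul_eq_mul, ← Finset.sum_const]
      exact Finset.sum_le_sum fun x hx => (hlt x hx).trans_le (hnb x hx)
    have h6 : ∑ b ∈ Y, (O b ∩ X).card ≤ Y.card * 6 := by
      rw [← smul_eq_mul, ← Finset.sum_const]
      exact Finset.sum_le_sum fun b hb => (Finset.card_le_card Finset.inter_subset_left).trans
        (hO6 b (Finset.mem_filter.1 hb).1)
    have := hne.card_pos
    omega)
  refine ⟨ψ, fun b hb a ha a' ha' heq => ?_⟩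
  by_contra hne
  exact hψ a (Finset.mem_univ _) a' (Finset.mem_univ _) hne ⟨b, hb, ha, ha'⟩ heq

/-- Each a is owned by its lowest-ranked neighbour F a, and b has at most 6 neighbours owned by
others, collected in O b. Blocks are indexed by the colour of the owner under a 7-colouring φ and by
a colouring ψ injective on each O b. In a block of b's own colour, all neighbours of b are owned by
b and are consecutive in ω; in any other block, b has at most one neighbour. -/
theorem IsSparse.exists_separates {N : B → Finset A} {S : Finset B} (h : IsSparse N S) :
    ∃ (T : Fin 7 × Fin 109 → Set A) (ω : A → ℕ), Separates N S T ω := by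
  classical
  obtain ⟨ρ, hinj, hρ⟩ := exists_elimination_rank
    (fun b Y => ((N b).filter fun a => ∃ b' ∈ Y, b' ≠ b ∧ a ∈ N b').card ≤ 6) S
    (fun Y hY hne => h.exists_few_shared hY hne)
  have hF : ∀ a, ∃ F : Option B, (F = none ∧ ∀ b ∈ S, a ∉ N b) ∨
      ∃ b ∈ S, F = some b ∧ a ∈ N b ∧ ∀ b' ∈ S, a ∈ N b' → ρ b ≤ ρ b' := by
    intro a
    by_cases hne : (S.filter fun b => a ∈ N b).Nonempty
    · obtain ⟨b, hb, hmin⟩ := Finset.exists_min_image _ ρ hne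
      rw [Finset.mem_filter] at hb
      exact ⟨some b, Or.inr ⟨b, hb.1, rfl, hb.2, fun b' h1 h2 =>
        hmin b' (Finset.mem_filter.2 ⟨h1, h2⟩)⟩⟩
    · refine ⟨none, Or.inl ⟨rfl, fun b hb hab => hne ⟨b, Finset.mem_filter.2 ⟨hb, hab⟩⟩⟩⟩
  choose F hF using hF
  have hFsome : ∀ a b, F a = some b → b ∈ S ∧ a ∈ N b ∧ ∀ b' ∈ S, a ∈ N b' → ρ b ≤ ρ b' := by
    intro a b hab
    rcases hF a with ⟨h0, -⟩ | ⟨b', h1, h2, h3, h4⟩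
    · simp [h0] at hab
    · obtain rfl : b' = b := Option.some.inj (h2.symm.trans hab)
      exact ⟨h1, h3, h4⟩
  have hFmem : ∀ a, ∀ b ∈ S, a ∈ N b → ∃ b', F a = some b' := by
    intro a b hb hab
    rcases hF a with ⟨-, h0⟩ | ⟨b', h1, h2, h3, h4⟩
    · exact absurd hab (h0 b hb)
    · exact ⟨b', h2⟩
  let O : B → Finset A := fun b => (N b).filter fun a => F a ≠ some b
  have hO6 : ∀ b ∈ S, (O b).card ≤ 6 := by
    intro b hb
    refine (Finset.card_le_card ?_).trans (hρ b hb)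
    intro a ha
    obtain ⟨ha1, ha2⟩ := Finset.mem_filter.1 ha
    obtain ⟨b', hb'⟩ := hFmem a b hb ha1
    obtain ⟨h1, h2, h3⟩ := hFsome a b' hb'
    refine Finset.mem_filter.2 ⟨ha1, b', Finset.mem_filter.2 ⟨h1, h3 b hb ha1⟩, ?_, h2⟩
    rintro rfl
    exact ha2 hb'
  obtain ⟨ψ, hψ⟩ := h.exists_rainbow O (fun b => Finset.filter_subset _ _) hO6
  obtain ⟨φ, hφ⟩ := exists_coloring_of_degenerate
    (fun b b' => (∃ a ∈ O b, F a = some b') ∨ ∃ a ∈ O b', F a = some b)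
    (fun u v huv => huv.symm) 6 S (by
    intro Y hY hne
    -- For b of largest rank in Y, a conflicting b' cannot have b as owner of one of its neighbours,
    -- so b' owns an element of O b; there are at most 6 of those.
    obtain ⟨b, hb, hmax⟩ := Finset.exists_max_image Y ρ hne
    refine ⟨b, hb, le_trans ?_ (hO6 b (hY hb))⟩
    have hsub : (Y.filter fun b' => b' ≠ b ∧
        ((∃ a ∈ O b, F a = some b') ∨ ∃ a ∈ O b', F a = some b)).image some ⊆ (O b).image F := by
      intro x hx
      obtain ⟨b', hb', rfl⟩ := Finset.mem_image.1 hx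
      obtain ⟨hb'Y, hne', ⟨a, ha, hFa⟩ | ⟨a, ha, hFa⟩⟩ := Finset.mem_filter.1 hb'
      · exact Finset.mem_image.2 ⟨a, ha, hFa⟩
      · have h1 := (hFsome a b hFa).2.2 b' (hY hb'Y) (Finset.mem_filter.1 ha).1
        exact absurd (hinj (hY hb'Y) (hY hb) (le_antisymm (hmax b' hb'Y) h1)) hne'
    have := Finset.card_le_card hsub
    rw [Finset.card_image_of_injective _ (Option.some_injective B)] at this
    exact this.trans Finset.card_image_le)
  -- A vertex without owner gets an arbitrary block colour and σ = 0, which the shift by one keeps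
  -- apart from all owned vertices. ω is lexicographic in (σ, index).
  let χ : A → Fin 7 := fun a => (F a).elim 0 φ
  let σ : A → ℕ := fun a => (F a).elim 0 fun b => ρ b + 1
  let e := Fintype.equivFin A
  let ω : A → ℕ := fun a => σ a * Fintype.card A + e a
  have hσω : ∀ a a', σ a < σ a' → ω a < ω a' := by
    intro a a' hlt
    have h1 : (σ a + 1) * Fintype.card A ≤ σ a' * Fintype.card A := Nat.mul_le_mul_right _ hlt
    have h2 := (e a).2
    simp only [ω]
    linarith
  have hω : ∀ a a', a ≠ a' → ω a < ω a' ∨ ω a' < ω a := by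
    intro a a' hne
    rcases lt_trichotomy (σ a) (σ a') with hlt | heq | hlt
    · exact Or.inl (hσω _ _ hlt)
    · have : (e a : ℕ) ≠ e a' := fun h => hne (e.injective (Fin.ext h))
      simp only [ω, heq]
      omega
    · exact Or.inr (hσω _ _ hlt)
  refine ⟨fun i => {a | χ a = i.1 ∧ ψ a = i.2}, ω, ?_⟩
  intro b hb a ha
  refine ⟨(χ a, ψ a), ⟨rfl, rfl⟩, ?_⟩
  by_cases hcase : φ b = χ a
  -- All neighbours of b in the block share the value σ = ρ b + 1, which the non-neighbour a cannot
  -- have, so a lies above or below all of them.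
  · have hstar : ∀ a' ∈ N b, χ a' = χ a → σ a' = ρ b + 1 := by
      intro a' ha' hχ
      by_cases hFa : F a' = some b
      · simp [σ, hFa]
      · obtain ⟨b₁, hb₁⟩ := hFmem a' b hb ha'
        have hne : b ≠ b₁ := by rintro rfl; exact hFa hb₁
        refine absurd ?_ (hφ b hb b₁ (hFsome _ _ hb₁).1 hne
          (Or.inl ⟨a', Finset.mem_filter.2 ⟨ha', hFa⟩, hb₁⟩))
        rw [hcase, ← hχ]
        simp [χ, hb₁]
    have hσa : σ a ≠ ρ b + 1 := by
      intro hσ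
      rcases hFa : F a with _ | b₁
      · simp [σ, hFa] at hσ
      · obtain ⟨h1, h2, -⟩ := hFsome _ _ hFa
        simp only [σ, hFa, Option.elim_some, add_left_inj] at hσ
        obtain rfl := hinj h1 hb hσ
        exact ha h2
    rcases lt_or_gt_of_ne hσa with hlt | hlt
    · right
      rintro a' ha' ⟨hT, -⟩
      exact hσω _ _ (by rw [hstar a' ha' hT]; exact hlt)
    · left
      rintro a' ha' ⟨hT, -⟩
      exact hσω _ _ (by rw [hstar a' ha' hT]; exact hlt)
  -- Now every neighbour of b in the block lies in O b, and ψ leaves at most one.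
  · have hold : ∀ a' ∈ N b, χ a' = χ a → a' ∈ O b := by
      intro a' ha' hχ
      refine Finset.mem_filter.2 ⟨ha', fun hFa => hcase ?_⟩
      rw [← hχ]
      simp [χ, hFa]
    by_cases hex : ∃ a' ∈ N b, χ a' = χ a ∧ ψ a' = ψ a
    · obtain ⟨a', ha', h1, h2⟩ := hex
      have huniq : ∀ a'' ∈ N b, χ a'' = χ a ∧ ψ a'' = ψ a → a'' = a' := fun a'' ha'' h3 =>
        hψ b hb (hold _ ha'' h3.1) (hold _ ha' h1) (h3.2.trans h2.symm)
      have hne : a' ≠ a := by rintro rfl; exact ha ha'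
      rcases hω a' a hne with hlt | hlt
      · left
        intro a'' ha'' hT
        rwa [huniq a'' ha'' hT]
      · right
        intro a'' ha'' hT
        rwa [huniq a'' ha'' hT]
    · exact Or.inl fun a' ha' hT => absurd ⟨a', ha', hT⟩ hex

end Sparse

/-! ### Random colourings that separate most vertices. -/

/-- When f a = f a', overwriting f at a loses nothing, because the old value can be read off at a'.
-/
theorem card_collision_mul_le {A : Type*} [Fintype A] [DecidableEq A] (q : ℕ) {a a' : A}
    (hne : a ≠ a') :
    (Finset.univ.filter fun f : A → Fin q => f a = f a').card * q ≤ q ^ Fintype.card A := by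
  have h := Finset.card_le_card_of_injOn
    (s := (Finset.univ.filter fun f : A → Fin q => f a = f a') ×ˢ (Finset.univ : Finset (Fin q)))
    (t := (Finset.univ : Finset (A → Fin q))) (fun x => Function.update x.1 a x.2)
    (fun _ _ => Finset.mem_coe.2 (Finset.mem_univ _)) (by
      rintro ⟨f, u⟩ hf ⟨g, v⟩ hg heq
      have hf' : f a = f a' := (Finset.mem_filter.1 (Finset.mem_product.1 hf).1).2
      have hg' : g a = g a' := (Finset.mem_filter.1 (Finset.mem_product.1 hg).1).2
      have h1 : ∀ x, Function.update f a u x = Function.update g a v x := fun x => congrFun heq x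
      have h2 : ∀ x, x ≠ a → f x = g x := fun x hx => by simpa [hx] using h1 x
      refine Prod.ext (funext fun x => ?_) (by simpa using h1 a)
      by_cases hx : x = a
      · rw [hx]
        exact hf'.trans ((h2 a' hne.symm).trans hg'.symm)
      · exact h2 x hx)
  simpa using h

theorem exists_le_of_sum_le_card_mul {Ω : Type*} [Fintype Ω] [Nonempty Ω] (F : Ω → ℝ) (c : ℝ)
    (h : ∑ x, F x ≤ Fintype.card Ω * c) : ∃ x, F x ≤ c := by
  obtain ⟨x, -, hx⟩ := Finset.exists_le_of_sum_le (s := Finset.univ) (f := F) (g := fun _ => c)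
    Finset.univ_nonempty (by simpa using h)
  exact ⟨x, hx⟩

/-- Some colouring with `q` colours is injective on most of the small sets `N b`. -/
theorem exists_mostly_rainbow {A B : Type*} [Fintype A] [DecidableEq A] (N : B → Finset A)
    (S : Finset B) (D q : ℕ) (hq : 0 < q) (hS : ∀ b ∈ S, (N b).card ≤ D) :
    ∃ f : A → Fin q, ∃ Z ⊆ S, (∀ b ∈ Z, Set.InjOn f (N b)) ∧
      ((S.card - Z.card : ℕ) : ℝ) ≤ S.card * (D ^ 2 / q : ℝ) := by
  classical
  have : Nonempty (Fin q) := ⟨⟨0, hq⟩⟩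
  have hq' : (0 : ℝ) < q := by exact_mod_cast hq
  let bad : (A → Fin q) → Finset B := fun f => S.filter fun b => ¬ Set.InjOn f (N b)
  have hb : ∀ b ∈ S, ((Finset.univ.filter fun f : A → Fin q => ¬ Set.InjOn f (N b)).card : ℝ) ≤
      Fintype.card (A → Fin q) * (D ^ 2 / q : ℝ) := by
    intro b hbS
    -- Union bound over fewer than D² or equally many ordered pairs, each colliding with probability
    -- at most 1/q.
    have h1 : (Finset.univ.filter fun f : A → Fin q => ¬ Set.InjOn f (N b)) ⊆
        (N b).offDiag.biUnion fun x => Finset.univ.filter fun f : A → Fin q => f x.1 = f x.2 := by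
      intro f hf
      have hf' := (Finset.mem_filter.1 hf).2
      simp only [Set.InjOn, not_forall] at hf'
      obtain ⟨a, ha, a', ha', heq, hne⟩ := hf'
      exact Finset.mem_biUnion.2 ⟨(a, a'), Finset.mem_offDiag.2 ⟨ha, ha', hne⟩,
        Finset.mem_filter.2 ⟨Finset.mem_univ _, heq⟩⟩
    have h2 : (Finset.univ.filter fun f : A → Fin q => ¬ Set.InjOn f (N b)).card * q ≤
        D ^ 2 * q ^ Fintype.card A := by
      calc _ ≤ (∑ x ∈ (N b).offDiag,
              (Finset.univ.filter fun f : A → Fin q => f x.1 = f x.2).card) * q :=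
            Nat.mul_le_mul_right _ ((Finset.card_le_card h1).trans Finset.card_biUnion_le)
        _ ≤ ∑ x ∈ (N b).offDiag, q ^ Fintype.card A := by
            rw [Finset.sum_mul]
            exact Finset.sum_le_sum fun x hx =>
              card_collision_mul_le q (Finset.mem_offDiag.1 hx).2.2
        _ ≤ D ^ 2 * q ^ Fintype.card A := by
            rw [Finset.sum_const, smul_eq_mul]
            refine Nat.mul_le_mul_right _ ?_
            rw [Finset.offDiag_card, sq]
            exact (Nat.sub_le _ _).trans (Nat.mul_le_mul (hS b hbS) (hS b hbS))
    have h3 : ((Finset.univ.filter fun f : A → Fin q => ¬ Set.InjOn f (N b)).card : ℝ) * q ≤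
        D ^ 2 * q ^ Fintype.card A := by exact_mod_cast h2
    rw [Fintype.card_fun, Fintype.card_fin, ← mul_div_assoc, le_div_iff₀ hq']
    push_cast
    linarith
  obtain ⟨f, hf⟩ := exists_le_of_sum_le_card_mul (fun f => ((bad f).card : ℝ))
    (S.card * (D ^ 2 / q : ℝ)) (by
    have hdc : ∑ f, (bad f).card = ∑ b ∈ S,
        (Finset.univ.filter fun f : A → Fin q => ¬ Set.InjOn f (N b)).card :=
      Finset.sum_card_bipartiteAbove_eq_sum_card_bipartiteBelow (s := Finset.univ) (t := S)
        (fun (f : A → Fin q) b => ¬ Set.InjOn f (N b))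
    have hdc' : ∑ f, ((bad f).card : ℝ) = ∑ b ∈ S,
        ((Finset.univ.filter fun f : A → Fin q => ¬ Set.InjOn f (N b)).card : ℝ) := by
      exact_mod_cast hdc
    rw [hdc']
    refine (Finset.sum_le_sum hb).trans (le_of_eq ?_)
    rw [Finset.sum_const, nsmul_eq_mul]
    ring)
  refine ⟨f, S.filter fun b => Set.InjOn f (N b), Finset.filter_subset _ _,
    fun b hb => (Finset.mem_filter.1 hb).2, le_trans (le_of_eq ?_) hf⟩
  have := Finset.card_filter_add_card_filter_not (s := S) (fun b => Set.InjOn f (N b))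
  simp only [bad]
  congr 1
  omega

theorem inv_exp_mul_le (d : ℕ) (hd : 1 ≤ d) :
    1 / (Real.exp 1 * (d + 1)) ≤ 1 / (d + 1 : ℝ) * (d / (d + 1)) ^ d := by
  have hd' : (0 : ℝ) < d := by exact_mod_cast hd
  have h1 : (1 + 1 / (d : ℝ)) ^ d ≤ Real.exp 1 := by
    calc (1 + 1 / (d : ℝ)) ^ d ≤ (Real.exp (1 / d)) ^ d := by
          gcongr
          rw [add_comm]
          exact Real.add_one_le_exp _
      _ = Real.exp 1 := by
          rw [← Real.exp_nat_mul]
          congr 1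
          field_simp
  have h2 : (d / (d + 1) : ℝ) = (1 + 1 / (d : ℝ))⁻¹ := by
    field_simp
  rw [h2, inv_pow, mul_comm (Real.exp 1), ← one_div_mul_one_div]
  gcongr
  rw [one_div]
  gcongr

/-- A random function `Fin q → Fin (d + 1)` maps `t` and no element of the small set `S` to `0`
with not too small a probability. -/
theorem card_not_isolated_le {q d : ℕ} (hd : 1 ≤ d) (t : Fin q) (S : Finset (Fin q)) (ht : t ∉ S)
    (hS : S.card ≤ d) :
    ((Finset.univ.filter fun g : Fin q → Fin (d + 1) =>
      ¬ (g t = 0 ∧ ∀ s ∈ S, g s ≠ 0)).card : ℝ) ≤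
      (d + 1) ^ q * (1 - 1 / (Real.exp 1 * (d + 1))) := by
  classical
  have hd' : (0 : ℝ) < d := by exact_mod_cast hd
  -- The event is a product set: one value at t, d values on S, all d + 1 elsewhere.
  have hgood : (Finset.univ.filter fun g : Fin q → Fin (d + 1) => g t = 0 ∧ ∀ s ∈ S, g s ≠ 0) =
      Fintype.piFinset (fun i => if i = t then {0} else if i ∈ S then Finset.univ.erase 0
        else (Finset.univ : Finset (Fin (d + 1)))) := by
    ext g
    simp only [Finset.mem_filter, Finset.mem_univ, true_and, Fintype.mem_piFinset]
    constructor
    · rintro ⟨h1, h2⟩ i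
      split_ifs with hi hi'
      · simp [hi, h1]
      · simp [h2 i hi']
      · simp
    · intro h
      refine ⟨by simpa using h t, fun s hs => ?_⟩
      have hst : s ≠ t := by rintro rfl; exact ht hs
      simpa [hst, hs] using h s
  have hcard : ((Finset.univ.filter fun g : Fin q → Fin (d + 1) =>
      g t = 0 ∧ ∀ s ∈ S, g s ≠ 0).card : ℝ) =
      (d + 1) ^ q * (1 / (d + 1) * (d / (d + 1)) ^ S.card) := by
    rw [hgood, Fintype.card_piFinset]
    push_cast
    have h1 : ∀ i : Fin q, (((if i = t then {0} else if i ∈ S then Finset.univ.erase 0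
        else (Finset.univ : Finset (Fin (d + 1)))).card : ℕ) : ℝ) = (d + 1) *
        (if i ∈ insert t S then (if i = t then 1 / (d + 1 : ℝ) else d / (d + 1)) else 1) := by
      intro i
      by_cases hi : i = t
      · simp only [hi, if_true, Finset.mem_insert_self, Finset.card_singleton]
        field_simp
        simp
      · by_cases hi' : i ∈ S
        · simp only [hi, hi', if_true, if_false, Finset.mem_insert, or_true,
            Finset.card_erase_of_mem (Finset.mem_univ _), Finset.card_fin]
          field_simp
          simp
        · simp [hi, hi']
    rw [Finset.prod_congr rfl fun i _ => h1 i, Finset.prod_mul_distrib, Finset.prod_const,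
      Finset.card_fin, Finset.prod_ite_mem, Finset.univ_inter, Finset.prod_insert ht, if_pos rfl]
    congr 2
    rw [← Finset.prod_const]
    refine Finset.prod_congr rfl fun i hi => if_neg ?_
    rintro rfl
    exact ht hi
  have hadd := Finset.card_filter_add_card_filter_not
    (s := (Finset.univ : Finset (Fin q → Fin (d + 1)))) (fun g => g t = 0 ∧ ∀ s ∈ S, g s ≠ 0)
  rw [Finset.card_univ, Fintype.card_fun, Fintype.card_fin, Fintype.card_fin] at hadd
  have hadd' : ((Finset.univ.filter fun g : Fin q → Fin (d + 1) =>
      g t = 0 ∧ ∀ s ∈ S, g s ≠ 0).card : ℝ) + ((Finset.univ.filter fun g : Fin q → Fin (d + 1) =>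
      ¬ (g t = 0 ∧ ∀ s ∈ S, g s ≠ 0)).card : ℝ) = (d + 1) ^ q := by exact_mod_cast hadd
  have hpow : (d / (d + 1) : ℝ) ^ d ≤ (d / (d + 1) : ℝ) ^ S.card :=
    pow_le_pow_of_le_one (by positivity) (by rw [div_le_one (by positivity)]; linarith) hS
  have hlow : (d + 1 : ℝ) ^ q * (1 / (Real.exp 1 * (d + 1))) ≤
      (d + 1) ^ q * (1 / (d + 1) * (d / (d + 1)) ^ S.card) := by
    gcongr
    exact (inv_exp_mul_le d hd).trans (by gcongr)
  linarith

/-- `k` random sets of colours isolate every colour from all others on most of the `N b`. -/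
theorem exists_separates_of_rainbow {A B : Type*} [DecidableEq A] (N : B → Finset A)
    (S : Finset B) (d q k : ℕ) (hd : 1 ≤ d) (hS : ∀ b ∈ S, (N b).card ≤ d) (f : A → Fin q)
    (hf : ∀ b ∈ S, Set.InjOn f (N b)) (ω : A → ℕ) (hω : Function.Injective ω) :
    ∃ T : Fin k → Set A, ∃ Z ⊆ S, Separates N Z T ω ∧ ((S.card - Z.card : ℕ) : ℝ) ≤
      S.card * (q * (1 - 1 / (Real.exp 1 * (d + 1))) ^ k) := by
  classical
  let ok : Fin q → B → (Fin q → Fin (d + 1)) → Prop := fun t b g =>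
    g t = 0 ∧ ∀ s ∈ ((N b).image f).erase t, g s ≠ 0
  let Ω := Fin k → Fin q → Fin (d + 1)
  have hΩ : (Fintype.card Ω : ℝ) = ((d + 1 : ℝ) ^ q) ^ k := by
    simp [Ω]
  let bad : Ω → Finset B := fun G => S.filter fun b => ∃ t, ∀ i, ¬ ok t b (G i)
  have hb : ∀ b ∈ S, ((Finset.univ.filter fun G : Ω => ∃ t, ∀ i, ¬ ok t b (G i)).card : ℝ) ≤
      Fintype.card Ω * (q * (1 - 1 / (Real.exp 1 * (d + 1))) ^ k) := by
    intro b hbS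
    -- Union bound over the q colours t; for fixed t the k independent trials must all fail.
    have h1 : (Finset.univ.filter fun G : Ω => ∃ t, ∀ i, ¬ ok t b (G i)) ⊆
        Finset.univ.biUnion fun t =>
          Fintype.piFinset fun _ : Fin k => Finset.univ.filter fun g => ¬ ok t b g := by
      intro G hG
      obtain ⟨t, ht⟩ := (Finset.mem_filter.1 hG).2
      exact Finset.mem_biUnion.2 ⟨t, Finset.mem_univ _, Fintype.mem_piFinset.2 fun i =>
        Finset.mem_filter.2 ⟨Finset.mem_univ _, ht i⟩⟩
    have h2 : ∀ t, ((Finset.univ.filter fun g => ¬ ok t b g).card : ℝ) ≤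
        (d + 1) ^ q * (1 - 1 / (Real.exp 1 * (d + 1))) := fun t =>
      card_not_isolated_le hd t _ (Finset.notMem_erase _ _)
        (((Finset.card_le_card (Finset.erase_subset _ _)).trans Finset.card_image_le).trans
          (hS b hbS))
    calc ((Finset.univ.filter fun G : Ω => ∃ t, ∀ i, ¬ ok t b (G i)).card : ℝ)
        ≤ ∑ t : Fin q, ((Finset.univ.filter fun g => ¬ ok t b g).card : ℝ) ^ k := by
          have h3 := (Finset.card_le_card h1).trans Finset.card_biUnion_le
          have h4 : ∀ t, (Fintype.piFinset fun _ : Fin k =>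
              Finset.univ.filter fun g => ¬ ok t b g).card =
              (Finset.univ.filter fun g => ¬ ok t b g).card ^ k := fun t => by
            exact Fintype.card_piFinset_const _ _
          rw [Finset.sum_congr rfl fun t _ => h4 t] at h3
          exact_mod_cast h3
      _ ≤ ∑ t : Fin q, ((d + 1) ^ q * (1 - 1 / (Real.exp 1 * (d + 1)))) ^ k := by
          gcongr with t
          exact h2 t
      _ = _ := by
          rw [Finset.sum_const, Finset.card_fin, nsmul_eq_mul, hΩ, mul_pow]
          ring
  obtain ⟨G, hG⟩ := exists_le_of_sum_le_card_mul (fun G => ((bad G).card : ℝ))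
    (S.card * (q * (1 - 1 / (Real.exp 1 * (d + 1))) ^ k)) (by
    have hdc : ∑ G, (bad G).card = ∑ b ∈ S,
        (Finset.univ.filter fun G : Ω => ∃ t, ∀ i, ¬ ok t b (G i)).card :=
      Finset.sum_card_bipartiteAbove_eq_sum_card_bipartiteBelow (s := Finset.univ) (t := S)
        (fun (G : Ω) b => ∃ t, ∀ i, ¬ ok t b (G i))
    have hdc' : ∑ G, ((bad G).card : ℝ) = ∑ b ∈ S,
        ((Finset.univ.filter fun G : Ω => ∃ t, ∀ i, ¬ ok t b (G i)).card : ℝ) := by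
      exact_mod_cast hdc
    rw [hdc']
    refine (Finset.sum_le_sum hb).trans (le_of_eq ?_)
    rw [Finset.sum_const, nsmul_eq_mul]
    ring)
  refine ⟨fun i => {a | G i (f a) = 0}, S.filter fun b => ¬ ∃ t, ∀ i, ¬ ok t b (G i),
    Finset.filter_subset _ _, ?_, le_trans (le_of_eq ?_) hG⟩
  · intro b hb a ha
    obtain ⟨hbS, hb⟩ := Finset.mem_filter.1 (Finset.mem_coe.1 hb)
    push Not at hb
    -- The i-th set contains the colour of a and no other colour of N b, so by injectivity of f it
    -- meets N b in at most one vertex.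
    obtain ⟨i, h0, hi⟩ := hb (f a)
    refine ⟨i, h0, ?_⟩
    have hsame : ∀ a' ∈ N b, G i (f a') = 0 → f a' = f a := by
      intro a' ha' h
      by_contra hne
      exact hi (f a') (Finset.mem_erase.2 ⟨hne, Finset.mem_image_of_mem f ha'⟩) h
    by_cases hex : ∃ a' ∈ N b, f a' = f a
    · obtain ⟨a', ha', h1⟩ := hex
      have huniq : ∀ a'' ∈ N b, G i (f a'') = 0 → a'' = a' := fun a'' ha'' h3 =>
        hf b hbS ha'' ha' ((hsame a'' ha'' h3).trans h1.symm)
      have hne : ω a' ≠ ω a := fun h => by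
        obtain rfl := hω h
        exact ha ha'
      rcases lt_or_gt_of_ne hne with hlt | hlt
      · left
        intro a'' ha'' hT
        rwa [huniq a'' ha'' hT]
      · right
        intro a'' ha'' hT
        rwa [huniq a'' ha'' hT]
    · exact Or.inl fun a' ha' hT => absurd ⟨a', ha', hsame a' ha' hT⟩ hex
  · have := Finset.card_filter_add_card_filter_not (s := S) (fun b => ∃ t, ∀ i, ¬ ok t b (G i))
    simp only [bad]
    congr 1
    omega

theorem exists_mostly_separates {A B : Type*} [Fintype A] [DecidableEq A] (N : B → Finset A)
    (S : Finset B) (d q k : ℕ) (hd : 1 ≤ d) (hq : 0 < q) (hS : ∀ b ∈ S, (N b).card ≤ d) :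
    ∃ (T : Fin k → Set A) (ω : A → ℕ), ∃ Z ⊆ S, Separates N Z T ω ∧
      ((S.card - Z.card : ℕ) : ℝ) ≤
        S.card * (d ^ 2 / q + q * (1 - 1 / (Real.exp 1 * (d + 1))) ^ k) := by
  obtain ⟨f, Z, hZS, hf, hZ⟩ := exists_mostly_rainbow N S d q hq hS
  obtain ⟨T, Z', hZ', hT, hc⟩ := exists_separates_of_rainbow N Z d q k hd
    (fun b hb => hS b (hZS hb)) f hf (fun a => Fintype.equivFin A a)
    (Fin.val_injective.comp (Fintype.equivFin A).injective)
  refine ⟨T, _, Z', hZ'.trans hZS, hT, ?_⟩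
  have h1 := Finset.card_le_card hZS
  have h2 := Finset.card_le_card hZ'
  have h3 : (Z.card : ℝ) ≤ S.card := by exact_mod_cast h1
  rw [Nat.cast_sub h1] at hZ
  rw [Nat.cast_sub h2] at hc
  rw [Nat.cast_sub (h2.trans h1)]
  have hpos : 0 ≤ 1 - 1 / (Real.exp 1 * (d + 1 : ℝ)) := by
    rw [sub_nonneg, div_le_one (by positivity)]
    have := Real.add_one_le_exp 1
    have hd' : (0 : ℝ) ≤ d := by positivity
    nlinarith
  have h4 : (Z.card : ℝ) * (q * (1 - 1 / (Real.exp 1 * (d + 1))) ^ k) ≤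
      S.card * (q * (1 - 1 / (Real.exp 1 * (d + 1))) ^ k) := by gcongr
  linarith

/-! ### Union bounds for the random bipartite graph. -/

open ProbabilityTheory

instance {n : ℕ} {p : unitInterval} : IsProbabilityMeasure (randomBipartite n p) := by
  unfold randomBipartite
  infer_instance

theorem prob_subset {n : ℕ} (p : unitInterval) (F : Finset (Fin n × Fin n)) :
    (randomBipartite n p).real {E | ∀ q ∈ F, q ∈ E} = (p : ℝ) ^ F.card := by
  have h : randomBipartite n p {E | ∀ q ∈ F, q ∈ E} =
      (unitInterval.toNNReal p : ENNReal) ^ F.card := by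
    have hset : (fun P : Fin n × Fin n → Prop => {i | P i}) ⁻¹' {E | ∀ q ∈ F, q ∈ E} =
        Set.pi F (fun _ => {True}) := by
      ext P
      simp [Set.mem_pi]
    rw [randomBipartite, setBernoulli_apply', hset,
      Measure.infinitePi_pi _ (fun _ _ => .of_discrete)]
    simp
  rw [measureReal_def, h]
  simp

theorem prob_disjoint {n : ℕ} (p : unitInterval) (F : Finset (Fin n × Fin n)) :
    (randomBipartite n p).real {E | ∀ q ∈ F, q ∉ E} = (1 - p : ℝ) ^ F.card := by
  have h : randomBipartite n p {E | ∀ q ∈ F, q ∉ E} =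
      (unitInterval.toNNReal (unitInterval.symm p) : ENNReal) ^ F.card := by
    have hset : (fun P : Fin n × Fin n → Prop => {i | P i}) ⁻¹' {E | ∀ q ∈ F, q ∉ E} =
        Set.pi F (fun _ => {False}) := by
      ext P
      simp [Set.mem_pi]
    rw [randomBipartite, setBernoulli_apply', hset,
      Measure.infinitePi_pi _ (fun _ _ => .of_discrete)]
    simp
  rw [measureReal_def, h]
  simp

/-- The number of edges between `X ⊆ A` and `Y ⊆ B`. -/
noncomputable def edgeCount {n : ℕ} (E : Set (Fin n × Fin n)) (X Y : Finset (Fin n)) : ℕ :=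
  open Classical in ((X ×ˢ Y).filter fun q => q ∈ E).card

theorem sum_card_nbrs_inter {n : ℕ} (E : Set (Fin n × Fin n)) (X Y : Finset (Fin n)) :
    ∑ b ∈ Y, (nbrs E b ∩ X).card = edgeCount E X Y := by
  classical
  rw [edgeCount, Finset.card_eq_sum_card_fiberwise (f := Prod.snd) (t := Y)
    (fun q hq => (Finset.mem_product.1 (Finset.mem_filter.1 hq).1).2)]
  refine Finset.sum_congr rfl fun b hb => ?_
  refine Finset.card_bij (fun a _ => (a, b)) ?_ ?_ ?_
  · intro a ha
    obtain ⟨h1, h2⟩ := Finset.mem_inter.1 ha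
    simp [h2, hb, mem_nbrs.1 h1]
  · intro a _ a' _ h
    exact (Prod.mk.inj h).1
  · rintro ⟨a, b'⟩ hq
    simp only [Finset.mem_filter, Finset.mem_product] at hq
    obtain ⟨⟨⟨h1, h2⟩, h3⟩, rfl⟩ := hq
    exact ⟨a, Finset.mem_inter.2 ⟨mem_nbrs.2 h3, h1⟩, rfl⟩

theorem edgeCount_univ {n : ℕ} (E : Set (Fin n × Fin n)) :
    edgeCount E Finset.univ Finset.univ = E.ncard := by
  classical
  rw [edgeCount, Set.ncard_eq_toFinset_card']
  congr 1
  ext q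
  simp

theorem edgeCount_le {n : ℕ} (E : Set (Fin n × Fin n)) (X Y : Finset (Fin n)) :
    edgeCount E X Y ≤ X.card * Y.card := by
  classical
  rw [edgeCount, ← Finset.card_product]
  exact Finset.card_filter_le _ _

theorem prob_le_edgeCount {n : ℕ} (p : unitInterval) (X Y : Finset (Fin n)) (m : ℕ) :
    (randomBipartite n p).real {E | m ≤ edgeCount E X Y} ≤
      (X.card * Y.card).choose m * (p : ℝ) ^ m := by
  classical
  calc (randomBipartite n p).real {E | m ≤ edgeCount E X Y}
      ≤ (randomBipartite n p).real
          (⋃ F ∈ (X ×ˢ Y).powersetCard m, {E | ∀ q ∈ F, q ∈ E}) := by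
        refine measureReal_mono (fun E hE => ?_) (measure_ne_top _ _)
        obtain ⟨F, hF, hcard⟩ := Finset.exists_subset_card_eq hE
        refine Set.mem_iUnion₂.2 ⟨F, Finset.mem_powersetCard.2
          ⟨hF.trans (Finset.filter_subset _ _), hcard⟩, fun q hq => ?_⟩
        exact (Finset.mem_filter.1 (hF hq)).2
    _ ≤ ∑ F ∈ (X ×ˢ Y).powersetCard m,
          (randomBipartite n p).real {E | ∀ q ∈ F, q ∈ E} := measureReal_biUnion_finset_le _ _
    _ = ∑ F ∈ (X ×ˢ Y).powersetCard m, (p : ℝ) ^ m :=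
        Finset.sum_congr rfl fun F hF => by
          rw [prob_subset, (Finset.mem_powersetCard.1 hF).2]
    _ = _ := by
        rw [Finset.sum_const, Finset.card_powersetCard, Finset.card_product, nsmul_eq_mul]

theorem prob_exists_le_edgeCount {n : ℕ} (p : unitInterval) (x y m : ℕ) :
    (randomBipartite n p).real {E | ∃ X Y : Finset (Fin n), X.card = x ∧ Y.card = y ∧
      m ≤ edgeCount E X Y} ≤
      n.choose x * n.choose y * ((x * y).choose m * (p : ℝ) ^ m) := by
  classical
  calc _ ≤ (randomBipartite n p).real
          (⋃ Z ∈ (Finset.univ : Finset (Fin n)).powersetCard x ×ˢ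
            (Finset.univ : Finset (Fin n)).powersetCard y, {E | m ≤ edgeCount E Z.1 Z.2}) := by
        refine measureReal_mono ?_ (measure_ne_top _ _)
        rintro E ⟨X, Y, hX, hY, hm⟩
        exact Set.mem_iUnion₂.2 ⟨(X, Y), by simp [hX, hY], hm⟩
    _ ≤ ∑ Z ∈ (Finset.univ : Finset (Fin n)).powersetCard x ×ˢ
            (Finset.univ : Finset (Fin n)).powersetCard y,
          (randomBipartite n p).real {E | m ≤ edgeCount E Z.1 Z.2} :=
        measureReal_biUnion_finset_le _ _
    _ ≤ ∑ Z ∈ (Finset.univ : Finset (Fin n)).powersetCard x ×ˢ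
            (Finset.univ : Finset (Fin n)).powersetCard y,
          ((x * y).choose m * (p : ℝ) ^ m) := by
        refine Finset.sum_le_sum fun Z hZ => ?_
        obtain ⟨h1, h2⟩ := Finset.mem_product.1 hZ
        have := prob_le_edgeCount p Z.1 Z.2 m
        rwa [(Finset.mem_powersetCard.1 h1).2, (Finset.mem_powersetCard.1 h2).2] at this
    _ = _ := by
        rw [Finset.sum_const, Finset.card_product, Finset.card_powersetCard,
          Finset.card_powersetCard, Finset.card_fin, nsmul_eq_mul]
        push_cast
        ring

theorem prob_exists_empty_box {n : ℕ} (p : unitInterval) (s : ℕ) :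
    (randomBipartite n p).real {E | ∃ X Y : Finset (Fin n), X.card = s ∧ Y.card = s ∧
      ∀ a ∈ X, ∀ b ∈ Y, (a, b) ∉ E} ≤ (n.choose s : ℝ) ^ 2 * (1 - p : ℝ) ^ (s * s) := by
  classical
  calc _ ≤ (randomBipartite n p).real
          (⋃ Z ∈ (Finset.univ : Finset (Fin n)).powersetCard s ×ˢ
            (Finset.univ : Finset (Fin n)).powersetCard s, {E | ∀ q ∈ Z.1 ×ˢ Z.2, q ∉ E}) := by
        refine measureReal_mono ?_ (measure_ne_top _ _)
        rintro E ⟨X, Y, hX, hY, hm⟩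
        refine Set.mem_iUnion₂.2 ⟨(X, Y), by simp [hX, hY], fun q hq => ?_⟩
        obtain ⟨h1, h2⟩ := Finset.mem_product.1 hq
        exact hm q.1 h1 q.2 h2
    _ ≤ ∑ Z ∈ (Finset.univ : Finset (Fin n)).powersetCard s ×ˢ
            (Finset.univ : Finset (Fin n)).powersetCard s,
          (randomBipartite n p).real {E | ∀ q ∈ Z.1 ×ˢ Z.2, q ∉ E} :=
        measureReal_biUnion_finset_le _ _
    _ = ∑ Z ∈ (Finset.univ : Finset (Fin n)).powersetCard s ×ˢ
            (Finset.univ : Finset (Fin n)).powersetCard s, (1 - p : ℝ) ^ (s * s) := by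
        refine Finset.sum_congr rfl fun Z hZ => ?_
        obtain ⟨h1, h2⟩ := Finset.mem_product.1 hZ
        rw [prob_disjoint, Finset.card_product, (Finset.mem_powersetCard.1 h1).2,
          (Finset.mem_powersetCard.1 h2).2]
    _ = _ := by
        rw [Finset.sum_const, Finset.card_product, Finset.card_powersetCard, Finset.card_fin,
          nsmul_eq_mul]
        push_cast
        ring

theorem choose_le_exp_mul_div_pow (N m : ℕ) :
    (N.choose m : ℝ) ≤ (Real.exp 1 * N / m) ^ m := by
  rcases Nat.eq_zero_or_pos m with rfl | hm
  · simp
  have hm' : (0 : ℝ) < m := by exact_mod_cast hm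
  have h1 := Real.pow_div_factorial_le_exp (m : ℝ) hm'.le m
  have hf : (0 : ℝ) < m.factorial := by exact_mod_cast m.factorial_pos
  have h2 : (1 : ℝ) / m.factorial ≤ (Real.exp 1 / m) ^ m := by
    rw [div_pow, ← Real.exp_nat_mul, mul_one, le_div_iff₀ (by positivity), one_div_mul_eq_div]
    exact h1
  calc (N.choose m : ℝ) ≤ (N : ℝ) ^ m / m.factorial := Nat.choose_le_pow_div m N
    _ = (N : ℝ) ^ m * (1 / m.factorial) := by ring
    _ ≤ (N : ℝ) ^ m * (Real.exp 1 / m) ^ m := by gcongr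
    _ = _ := by rw [← mul_pow]; congr 1; ring

theorem choose_mul_pow_le (N m : ℕ) {p : ℝ} (hp : 0 ≤ p) :
    (N.choose m : ℝ) * p ^ m ≤ (Real.exp 1 * N * p / m) ^ m := by
  calc (N.choose m : ℝ) * p ^ m ≤ (Real.exp 1 * N / m) ^ m * p ^ m := by
        gcongr
        exact choose_le_exp_mul_div_pow N m
    _ = _ := by rw [← mul_pow]; congr 1; ring

theorem cube_le_four_pow (k : ℕ) : (k : ℝ) ^ 3 ≤ 4 ^ k := by
  have : k ^ 3 ≤ 4 ^ k := by
    induction k with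
    | zero => norm_num
    | succ k ih =>
      rcases Nat.lt_or_ge k 3 with hk | hk
      · interval_cases k <;> norm_num
      · rw [pow_succ 4 k]
        nlinarith [mul_le_mul hk hk (by norm_num) (by omega)]
  exact_mod_cast this

/-- The union bound for `x × y` boxes with at least `m > 3 (x + y) / 2` edges. -/
theorem dense_box_bound {n x y m : ℕ} {p C : ℝ} (hx : 1 ≤ x) (hy : 1 ≤ y) (hxn : x ≤ n)
    (hp : 0 ≤ p) (hpC : p * n ≤ C)
    (hm : 3 * (x + y) + 1 ≤ 2 * m)
    (hmin : 16 * (Real.exp 1 ^ 5 * C ^ 3) * (min x y : ℕ) ≤ n) (hC1 : 1 ≤ C) :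
    (n.choose x : ℝ) * n.choose y * ((x * y).choose m * p ^ m) ≤
      4096 * (Real.exp 1 ^ 5 * C ^ 3 / n) ^ 3 := by
  have hn : (0 : ℝ) < n := by exact_mod_cast (by omega : 0 < n)
  have he : 1 ≤ Real.exp 1 := Real.one_le_exp zero_le_one
  have hC : 0 ≤ C := by linarith
  set β := Real.exp 1 ^ 5 * C ^ 3 with hβ
  have hβ0 : 0 ≤ β := by positivity
  rcases Nat.lt_or_ge (x * y) m with hlt | hge
  · rw [Nat.choose_eq_zero_of_lt hlt]
    simp only [Nat.cast_zero, zero_mul, mul_zero]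
    positivity
  set k := x + y with hk
  set r := min x y with hr
  have hr1 : 1 ≤ r := le_min hx hy
  have hrx : r ≤ x := min_le_left _ _
  have hry : r ≤ y := min_le_right _ _
  -- For x + y ≤ 6 one has xy ≤ 3(x + y)/2 < m, which is excluded. At least 7 factors θ allow θ^6 to
  -- be split off below.
  have hk7 : 7 ≤ k := by
    by_contra! hlt
    have h1 : x ≤ 5 := by omega
    have h2 : y ≤ 5 := by omega
    interval_cases x <;> interval_cases y <;> omega
  have hr' : (0 : ℝ) < r := by exact_mod_cast hr1
  have hm0 : (0 : ℝ) < m := by exact_mod_cast (by omega : 0 < m)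
  have hchoose : ∀ z, r ≤ z → (n.choose z : ℝ) ≤ (Real.exp 1 * n / r) ^ z := by
    intro z hz
    refine (choose_le_exp_mul_div_pow n z).trans ?_
    gcongr
  have hxy : ((x * y : ℕ) : ℝ) / m ≤ r := by
    rw [div_le_iff₀ hm0]
    have : x * y ≤ r * m := by
      rcases le_total x y with h | h
      · rw [hr, min_eq_left h]
        exact Nat.mul_le_mul_left _ (by omega)
      · rw [hr, min_eq_right h, mul_comm]
        exact Nat.mul_le_mul_left _ (by omega)
    exact_mod_cast this
  have hpn : p ≤ C / n := by rwa [le_div_iff₀ hn]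
  set u := Real.exp 1 * r * C / n with hu
  have hu0 : 0 ≤ u := by positivity
  have hu1 : u ≤ 1 := by
    rw [hu, div_le_one hn]
    have h1 : Real.exp 1 ≤ Real.exp 1 ^ 5 := le_self_pow₀ he (by norm_num)
    have h2 : C ≤ C ^ 3 := le_self_pow₀ hC1 (by norm_num)
    have h3 : Real.exp 1 * C ≤ β := by
      rw [hβ]
      gcongr
    nlinarith [mul_nonneg hβ0 hr'.le]
  have hedge : ((x * y).choose m : ℝ) * p ^ m ≤ u ^ m := by
    refine (choose_mul_pow_le _ _ hp).trans ?_
    have : Real.exp 1 * ((x * y : ℕ) : ℝ) * p / m = Real.exp 1 * (((x * y : ℕ) : ℝ) / m) * p := by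
      ring
    rw [this]
    have h2 : u = Real.exp 1 * r * (C / n) := by rw [hu]; ring
    rw [h2]
    gcongr
  set w := Real.exp 1 * n / r with hw
  have hw0 : 0 ≤ w := by positivity
  have hP : (n.choose x : ℝ) * n.choose y * ((x * y).choose m * p ^ m) ≤ w ^ k * u ^ m := by
    rw [hk, pow_add]
    gcongr
    · exact hchoose x hrx
    · exact hchoose y hry
  -- Squaring avoids the half-integer exponent 3k/2: since u ≤ 1 and 2m ≥ 3k, the square is at most
  -- (w²u³)^k = θ^k. The factor θ^6 then yields n^{-3} in the unsquared bound, enough for the n²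
  -- pairs (x, y).
  refine hP.trans (le_of_sq_le_sq ?_ (by positivity))
  set θ := β * r / n with hθ
  have hθ0 : 0 ≤ θ := by positivity
  have hθ1 : θ ≤ 1 / 16 := by
    rw [hθ, div_le_iff₀ hn]
    linarith
  have hrk : (r : ℝ) ≤ k := by exact_mod_cast (by omega : r ≤ k)
  calc (w ^ k * u ^ m) ^ 2 = w ^ (2 * k) * u ^ (2 * m) := by ring
    _ ≤ w ^ (2 * k) * u ^ (3 * k) := by
        gcongr ?_ * ?_
        exact pow_le_pow_of_le_one hu0 hu1 (by omega)
    _ = (w ^ 2 * u ^ 3) ^ k := by rw [mul_pow, ← pow_mul, ← pow_mul]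
    _ = θ ^ k := by
        congr 1
        rw [hw, hu, hθ, hβ]
        field_simp
    _ = θ ^ 6 * θ ^ (k - 6) := by rw [← pow_add]; congr 1; omega
    _ ≤ (β * k / n) ^ 6 * (1 / 16) ^ (k - 6) := by
        gcongr
        rw [hθ]
        gcongr
    _ = (β / n) ^ 6 * 16 ^ 6 * ((k : ℝ) ^ 3 * (1 / 4) ^ k) ^ 2 := by
        have : (1 / 4 : ℝ) ^ k = (1 / 4) ^ (k - 6) * (1 / 4) ^ 6 := by
          rw [← pow_add]
          congr 1
          omega
        rw [this]
        have h16 : (1 / 16 : ℝ) ^ (k - 6) = ((1 / 4) ^ (k - 6)) ^ 2 := by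
          rw [← pow_mul, mul_comm, pow_mul]
          norm_num
        rw [h16]
        ring
    _ ≤ (β / n) ^ 6 * 16 ^ 6 * 1 ^ 2 := by
        gcongr
        rw [one_div, inv_pow, mul_inv_le_iff₀ (by positivity), one_mul]
        exact cube_le_four_pow k
    _ = (4096 * (β / n) ^ 3) ^ 2 := by ring

/-- Sparsity of the random graph: small sets span few edges. -/
theorem prob_exists_dense_le {n M : ℕ} (p : unitInterval) {C : ℝ} (hC1 : 1 ≤ C)
    (hpC : (p : ℝ) * n ≤ C) (hM : 16 * (Real.exp 1 ^ 5 * C ^ 3) * M ≤ n) :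
    (randomBipartite n p).real {E | ∃ X Y : Finset (Fin n), Y.card ≤ M ∧
      3 * (X.card + Y.card) < 2 * edgeCount E X Y} ≤
      4096 * (Real.exp 1 ^ 5 * C ^ 3) ^ 3 / n := by
  classical
  rcases Nat.eq_zero_or_pos n with rfl | hn
  · have : {E : Set (Fin 0 × Fin 0) | ∃ X Y : Finset (Fin 0), Y.card ≤ M ∧
      3 * (X.card + Y.card) < 2 * edgeCount E X Y} = ∅ := by
      refine Set.eq_empty_of_forall_notMem ?_
      rintro E ⟨X, Y, -, h⟩
      have := edgeCount_le E X Y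
      have h0 : X.card = 0 := by rw [Finset.eq_empty_of_isEmpty X, Finset.card_empty]
      rw [h0] at this h
      omega
    rw [this]
    simp
  have hn' : (0 : ℝ) < n := by exact_mod_cast hn
  let I := (Finset.Icc 1 n ×ˢ Finset.Icc 1 n).filter fun z : ℕ × ℕ => z.2 ≤ M
  -- The least integer exceeding 3(x + y)/2.
  let m : ℕ × ℕ → ℕ := fun z => (3 * (z.1 + z.2) + 2) / 2
  calc _ ≤ (randomBipartite n p).real (⋃ z ∈ I, {E | ∃ X Y : Finset (Fin n), X.card = z.1 ∧
          Y.card = z.2 ∧ m z ≤ edgeCount E X Y}) := by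
        refine measureReal_mono ?_ (measure_ne_top _ _)
        rintro E ⟨X, Y, hY, h⟩
        have h1 := edgeCount_le E X Y
        have hX0 : X.card ≠ 0 := by intro h0; rw [h0] at h1 h; omega
        have hY0 : Y.card ≠ 0 := by intro h0; rw [h0] at h1 h; omega
        have hXn := Finset.card_le_univ X
        have hYn := Finset.card_le_univ Y
        rw [Fintype.card_fin] at hXn hYn
        refine Set.mem_iUnion₂.2 ⟨(X.card, Y.card), ?_, X, Y, rfl, rfl, ?_⟩
        · simp only [I, Finset.mem_filter, Finset.mem_product, Finset.mem_Icc]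
          omega
        · simp only [m]
          omega
    _ ≤ ∑ z ∈ I, (randomBipartite n p).real {E | ∃ X Y : Finset (Fin n), X.card = z.1 ∧
          Y.card = z.2 ∧ m z ≤ edgeCount E X Y} := measureReal_biUnion_finset_le _ _
    _ ≤ ∑ z ∈ I, 4096 * (Real.exp 1 ^ 5 * C ^ 3 / n) ^ 3 := by
        refine Finset.sum_le_sum fun z hz => ?_
        simp only [I, Finset.mem_filter, Finset.mem_product, Finset.mem_Icc] at hz
        refine (prob_exists_le_edgeCount p _ _ _).trans
          (dense_box_bound hz.1.1.1 hz.1.2.1 hz.1.1.2 p.2.1 hpC ?_ ?_ hC1)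
        · simp only [m]
          omega
        -- Only the smaller side has to be small, so X may have any size.
        · refine le_trans ?_ hM
          have : ((min z.1 z.2 : ℕ) : ℝ) ≤ M := by
            exact_mod_cast (min_le_right _ _).trans hz.2
          gcongr
    _ ≤ (n : ℝ) ^ 2 * (4096 * (Real.exp 1 ^ 5 * C ^ 3 / n) ^ 3) := by
        rw [Finset.sum_const, nsmul_eq_mul]
        gcongr
        have : I.card ≤ n * n := by
          refine (Finset.card_filter_le _ _).trans ?_
          simp
        rw [sq]
        exact_mod_cast this
    _ = _ := by field_simp

/-! ### Asymptotically almost sure events. -/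

theorem aas_iff (p : ℕ → unitInterval) (S : (n : ℕ) → Set (Set (Fin n × Fin n))) :
    AAS p S ↔ Tendsto (fun n => (randomBipartite n (p n)).real (S n)ᶜ) atTop (𝓝 0) := by
  have h : ∀ n, randomBipartite n (p n) (S n) =
      ENNReal.ofReal (1 - (randomBipartite n (p n)).real (S n)ᶜ) := by
    intro n
    rw [probReal_compl_eq_one_sub (.of_discrete), sub_sub_cancel, ofReal_measureReal]
  have h' : ∀ n, (randomBipartite n (p n)).real (S n)ᶜ =
      1 - (randomBipartite n (p n) (S n)).toReal := fun n =>
    probReal_compl_eq_one_sub (.of_discrete)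
  constructor
  · intro hS
    have := (ENNReal.tendsto_toReal ENNReal.one_ne_top).comp hS
    have := this.const_sub 1
    simp only [ENNReal.toReal_one, sub_self] at this
    exact this.congr fun n => (h' n).symm
  · intro hS
    have := ENNReal.tendsto_ofReal (hS.const_sub 1)
    rw [sub_zero, ENNReal.ofReal_one] at this
    exact this.congr fun n => (h n).symm

theorem aas_of_prob_compl_le {p : ℕ → unitInterval} {S : (n : ℕ) → Set (Set (Fin n × Fin n))}
    {f : ℕ → ℝ} (hf : Tendsto f atTop (𝓝 0))
    (h : ∀ᶠ n in atTop, (randomBipartite n (p n)).real (S n)ᶜ ≤ f n) : AAS p S :=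
  (aas_iff p S).2 (squeeze_zero' (Eventually.of_forall fun _ => measureReal_nonneg) h hf)

theorem AAS.and {p : ℕ → unitInterval} {S T U : (n : ℕ) → Set (Set (Fin n × Fin n))}
    (hS : AAS p S) (hT : AAS p T) (h : ∀ᶠ n in atTop, S n ∩ T n ⊆ U n) : AAS p U := by
  have hsum := ((aas_iff p S).1 hS).add ((aas_iff p T).1 hT)
  rw [add_zero] at hsum
  refine aas_of_prob_compl_le hsum ?_
  filter_upwards [h] with n hn
  refine (measureReal_mono (?_ : (U n)ᶜ ⊆ (S n)ᶜ ∪ (T n)ᶜ) (measure_ne_top _ _)).trans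
    (measureReal_union_le _ _)
  rw [← Set.compl_inter]
  exact Set.compl_subset_compl.2 hn

/-! ### Estimates for α_c and the lower bound. -/

theorem sq_mul_exp_alpha {c : ℝ} (hc : 0 < c) :
    alpha c ^ 2 * Real.exp (c * alpha c) = Real.exp 2 := by
  obtain ⟨h1, h2⟩ := alpha_spec hc
  rw [Real.exp_neg] at h2
  have := Real.exp_pos (c * alpha c)
  field_simp at h2
  rw [mul_comm c]
  exact h2.symm

/-- As x²e^{cx} increases on the positive axis and equals e² at α_c, evaluating it at x compares x
with α_c. -/
theorem le_alpha {c x : ℝ} (hc : 0 < c) (h : x ^ 2 * Real.exp (c * x) ≤ Real.exp 2) :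
    x ≤ alpha c := by
  by_contra! hlt
  have h0 := (alpha_spec hc).1
  have h1 := sq_mul_exp_alpha hc
  have h2 : Real.exp (c * alpha c) ≤ Real.exp (c * x) := Real.exp_le_exp.2 (by gcongr)
  have h3 : alpha c ^ 2 < x ^ 2 := by gcongr
  have := mul_lt_mul h3 h2 (Real.exp_pos _) (by positivity)
  linarith

theorem alpha_le {c x : ℝ} (hc : 0 < c) (hx : 0 ≤ x)
    (h : Real.exp 2 ≤ x ^ 2 * Real.exp (c * x)) : alpha c ≤ x := by
  by_contra! hlt
  have h1 := sq_mul_exp_alpha hc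
  have h2 : Real.exp (c * x) ≤ Real.exp (c * alpha c) := Real.exp_le_exp.2 (by gcongr)
  have h3 : x ^ 2 < alpha c ^ 2 := by gcongr
  have := mul_lt_mul h3 h2 (Real.exp_pos _) (by positivity)
  linarith

theorem one_div_le_alpha {c : ℝ} (hc : 2 ≤ c) : 1 / c ≤ alpha c := by
  have hc0 : 0 < c := by linarith
  refine le_alpha hc0 ?_
  rw [mul_one_div_cancel hc0.ne']
  have h1 : (1 / c) ^ 2 ≤ 1 := by
    rw [div_pow, one_pow, div_le_one (by positivity)]
    nlinarith
  have h2 : Real.exp 1 ≤ Real.exp 2 := Real.exp_le_exp.2 (by norm_num)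
  nlinarith [Real.exp_pos 1]

theorem alpha_le_log_div {c : ℝ} (hc : 2 ≤ c) : alpha c ≤ 4 * Real.log c / c := by
  have hc0 : 0 < c := by linarith
  have hlog : 0.6931471803 < Real.log c :=
    Real.log_two_gt_d9.trans_le (Real.log_le_log (by norm_num) hc)
  refine alpha_le hc0 (by positivity) ?_
  have h1 : Real.exp (c * (4 * Real.log c / c)) = c ^ 4 := by
    rw [mul_div_cancel₀ _ hc0.ne', mul_comm, Real.exp_mul, Real.exp_log hc0]
    norm_cast
  have h2 : Real.exp 2 ≤ 9 := by
    have h3 : Real.exp 2 = Real.exp 1 ^ 2 := by rw [← Real.exp_nat_mul]; norm_num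
    rw [h3]
    nlinarith [Real.exp_one_lt_d9, Real.exp_pos 1]
  rw [h1]
  have h4 : (4 * Real.log c / c) ^ 2 * c ^ 4 = 16 * (Real.log c * c) ^ 2 := by
    field_simp
    ring
  rw [h4]
  have h5 : 1 ≤ Real.log c * c := by nlinarith
  nlinarith

/-- Above the threshold `αn` there are no empty boxes. -/
theorem empty_box_bound {n s : ℕ} {p c η : ℝ} (hn : 0 < n) (hc : 0 < c) (hp : p = c / n)
    (hp1 : p ≤ 1) (hη : 0 ≤ η) (hs0 : 0 < s) (hs : (1 + η) * (alpha c * n) ≤ s) :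
    (n.choose s : ℝ) ^ 2 * (1 - p) ^ (s * s) ≤ 1 / (1 + s * η) := by
  have hn' : (0 : ℝ) < n := by exact_mod_cast hn
  have hs' : (0 : ℝ) < s := by exact_mod_cast hs0
  have hα := (alpha_spec hc).1
  set x : ℝ := s / n with hx
  have hx0 : 0 < x := by positivity
  have hxα : (1 + η) * alpha c ≤ x := by
    rw [hx, le_div_iff₀ hn']
    linarith
  have h1 : (n.choose s : ℝ) ≤ (Real.exp 1 / x) ^ s := by
    refine (choose_le_exp_mul_div_pow n s).trans (le_of_eq ?_)
    congr 1
    rw [hx]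
    field_simp
  have h2 : (1 - p) ^ (s * s) ≤ (Real.exp (-(c * x))) ^ s := by
    rw [pow_mul]
    have : (1 - p) ^ s ≤ Real.exp (-(c * x)) := by
      calc (1 - p) ^ s ≤ (Real.exp (-p)) ^ s := by
            have := Real.add_one_le_exp (-p)
            exact pow_le_pow_left₀ (by linarith) (by linarith) s
        _ = Real.exp (-(c * x)) := by
            rw [← Real.exp_nat_mul, hp, hx]
            congr 1
            ring
    have h0 : 0 ≤ 1 - p := by linarith
    gcongr
  -- Being a factor 1 + η above α_c gains (1 + η)² in the base; Bernoulli's inequality later turns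
  -- its s-th power into 1 + sη.
  have h3 : Real.exp 2 ≤ x ^ 2 * Real.exp (c * x) / (1 + η) ^ 2 := by
    rw [le_div_iff₀ (by positivity), ← sq_mul_exp_alpha hc]
    have hle : alpha c ≤ x := by nlinarith
    calc alpha c ^ 2 * Real.exp (c * alpha c) * (1 + η) ^ 2
        = ((1 + η) * alpha c) ^ 2 * Real.exp (c * alpha c) := by ring
      _ ≤ x ^ 2 * Real.exp (c * x) := by gcongr
  have h4 : (Real.exp 1 / x) ^ 2 * Real.exp (-(c * x)) ≤ 1 / (1 + η) ^ 2 := by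
    rw [Real.exp_neg, div_pow, ← Real.exp_nat_mul, Nat.cast_ofNat, mul_one]
    have he := Real.exp_pos (c * x)
    rw [le_div_iff₀ (by positivity)] at h3
    rw [div_mul_eq_mul_div, div_le_div_iff₀ (by positivity) (by positivity),
      mul_assoc, ← div_eq_inv_mul, one_mul, ← mul_div_assoc, div_le_iff₀ he]
    exact h3
  calc (n.choose s : ℝ) ^ 2 * (1 - p) ^ (s * s)
      ≤ ((Real.exp 1 / x) ^ s) ^ 2 * (Real.exp (-(c * x))) ^ s := by
        have : 0 ≤ (1 - p) ^ (s * s) := pow_nonneg (by linarith) _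
        gcongr
    _ = ((Real.exp 1 / x) ^ 2 * Real.exp (-(c * x))) ^ s := by
        rw [mul_pow, ← pow_mul, ← pow_mul, mul_comm s 2]
    _ ≤ (1 / (1 + η) ^ 2) ^ s := by gcongr
    _ = 1 / ((1 + η) ^ s) ^ 2 := by rw [div_pow, one_pow, ← pow_mul, ← pow_mul, mul_comm 2 s]
    _ ≤ 1 / (1 + s * η) := by
        have hb := one_add_mul_le_pow (by linarith : (-2 : ℝ) ≤ η) s
        have hpos : 0 < 1 + s * η := by positivity
        have h1' : 1 ≤ (1 + η) ^ s := one_le_pow₀ (by linarith)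
        refine one_div_le_one_div_of_le hpos ?_
        nlinarith

theorem prob_many_edges_le {n m : ℕ} (p : unitInterval) {c : ℝ} (hn : 0 < n)
    (hp : (p : ℝ) = c / n) (hm : 8 * (c * n) ≤ m) (hm0 : 0 < m) :
    (randomBipartite n p).real {E | m ≤ E.ncard} ≤ (1 / 2) ^ m := by
  have hn' : (0 : ℝ) < n := by exact_mod_cast hn
  have hm' : (0 : ℝ) < m := by exact_mod_cast hm0
  have h := prob_le_edgeCount p (Finset.univ : Finset (Fin n)) Finset.univ m
  simp only [edgeCount_univ, Finset.card_fin] at h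
  refine h.trans ((choose_mul_pow_le _ _ p.2.1).trans ?_)
  have hp0 : 0 ≤ (p : ℝ) := p.2.1
  refine pow_le_pow_left₀ (by positivity) ?_ m
  rw [hp, div_le_iff₀ hm']
  push_cast
  have : Real.exp 1 * (n * n) * (c / n) = Real.exp 1 * (c * n) := by field_simp
  rw [this]
  have hcn : 0 ≤ c * n := by
    have : 0 ≤ c := by
      by_contra! hc
      have := div_neg_of_neg_of_pos hc hn'
      linarith
    positivity
  nlinarith [Real.exp_one_lt_d9]

theorem le_dim_of_no_empty_box {n s m : ℕ} (hn : 0 < n) (hs : 0 < s) {E : Set (Fin n × Fin n)}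
    (hbox : ¬ ∃ X Y : Finset (Fin n), X.card = s ∧ Y.card = s ∧ ∀ a ∈ X, ∀ b ∈ Y, (a, b) ∉ E)
    (hm : ¬ m ≤ E.ncard) :
    (1 - m / (n : ℝ) ^ 2) * (n / (2 * s)) ≤ (dim (bipartiteOrder E) : ℝ) := by
  have hn' : (0 : ℝ) < n := by exact_mod_cast hn
  have hs' : (0 : ℝ) < s := by exact_mod_cast hs
  push Not at hbox
  have h := sq_le_ncard_add_dim_mul (s := s) (E := E) hbox
  have h' : (n : ℝ) ^ 2 ≤ E.ncard + dim (bipartiteOrder E) * (2 * s * n) := by exact_mod_cast h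
  have h2 : (E.ncard : ℝ) ≤ m := by exact_mod_cast (by omega : E.ncard ≤ m)
  have h3 : (1 - m / (n : ℝ) ^ 2) * (n / (2 * s)) = ((n : ℝ) ^ 2 - m) / (2 * s * n) := by
    field_simp
  rw [h3, div_le_iff₀ (by positivity)]
  linarith

theorem tendsto_log_pow_div (k : ℕ) :
    Tendsto (fun n : ℕ => Real.log n ^ k / n) atTop (𝓝 0) :=
  (Real.isLittleO_pow_log_id_atTop (n := k)).tendsto_div_nhds_zero.comp
    tendsto_natCast_atTop_atTop

theorem exists_aas_le_dim (c : ℕ → ℝ) (p : ℕ → unitInterval)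
    (h : ∀ᶠ n : ℕ in atTop, 2 ≤ c n ∧ c n ≤ (Real.log n) ^ 2 ∧ (p n : ℝ) = c n / n) :
    ∃ ε : ℕ → ℝ, Tendsto ε atTop (𝓝 0) ∧ AAS p (fun n => {E |
      (1 - ε n) * (1 / (2 * alpha (c n))) ≤ (dim (bipartiteOrder E) : ℝ)}) := by
  -- η must vanish while sη tends to infinity; since s ≥ n/log² n, 1/√n does both. m is 8 times an
  -- upper bound for the expected number of edges.
  let η : ℕ → ℝ := fun n => 1 / √n
  let s : ℕ → ℕ := fun n => ⌈(1 + η n) * (alpha (c n) * n)⌉₊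
  let m : ℕ → ℕ := fun n => ⌈8 * (Real.log n ^ 2 * n)⌉₊
  have hlog : Tendsto (fun n : ℕ => Real.log n) atTop atTop :=
    Real.tendsto_log_atTop.comp tendsto_natCast_atTop_atTop
  have hη : Tendsto η atTop (𝓝 0) := by
    have := (Real.tendsto_sqrt_atTop.comp tendsto_natCast_atTop_atTop).inv_tendsto_atTop
    exact this.congr fun n => by simp [η]
  have hbasic : ∀ᶠ n : ℕ in atTop, (0 : ℝ) < n ∧ 2 ≤ c n ∧ c n ≤ Real.log n ^ 2 ∧
      (p n : ℝ) = c n / n ∧ 1 ≤ Real.log n ∧ 0 < alpha (c n) ∧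
      1 / (alpha (c n) * n) ≤ Real.log n ^ 2 / n := by
    filter_upwards [h, eventually_gt_atTop 0, hlog.eventually_ge_atTop 1] with n hn hn0 hl
    obtain ⟨h1, h2, h3⟩ := hn
    have hn' : (0 : ℝ) < n := by exact_mod_cast hn0
    have hα := one_div_le_alpha h1
    have hα0 : 0 < alpha (c n) := (alpha_spec (by linarith)).1
    refine ⟨hn', h1, h2, h3, hl, hα0, ?_⟩
    rw [div_le_div_iff₀ (by positivity) hn', one_mul]
    rw [div_le_iff₀ (by linarith)] at hα
    have : 1 ≤ Real.log n ^ 2 * alpha (c n) := by nlinarith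
    nlinarith
  have hratio : Tendsto (fun n => (s n : ℝ) / (alpha (c n) * n)) atTop (𝓝 1) := by
    have hup : Tendsto (fun n => 1 + η n + Real.log n ^ 2 / n) atTop (𝓝 1) := by
      simpa using (hη.const_add 1).add (tendsto_log_pow_div 2)
    refine tendsto_of_tendsto_of_tendsto_of_le_of_le' tendsto_const_nhds hup ?_ ?_
    · filter_upwards [hbasic] with n ⟨hn, h1, h2, h3, h4, h5, h6⟩
      rw [le_div_iff₀ (by positivity)]
      refine le_trans ?_ (Nat.le_ceil _)
      have : 0 ≤ η n := by positivity
      gcongr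
      linarith
    · filter_upwards [hbasic] with n ⟨hn, h1, h2, h3, h4, h5, h6⟩
      have h7 : 0 ≤ η n := by positivity
      have h8 := (Nat.ceil_lt_add_one
        (by positivity : 0 ≤ (1 + η n) * (alpha (c n) * n))).le
      have h9 : (s n : ℝ) / (alpha (c n) * n) ≤ 1 + η n + 1 / (alpha (c n) * n) := by
        rw [div_le_iff₀ (by positivity), add_mul, one_div_mul_cancel (by positivity)]
        exact h8
      linarith
  have hmn : Tendsto (fun n => (m n : ℝ) / (n : ℝ) ^ 2) atTop (𝓝 0) := by
    have hup : Tendsto (fun n : ℕ => 8 * (Real.log n ^ 2 / n) + Real.log n ^ 0 / n) atTop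
        (𝓝 0) := by
      simpa using ((tendsto_log_pow_div 2).const_mul 8).add (tendsto_log_pow_div 0)
    refine squeeze_zero' (Eventually.of_forall fun n => by positivity) ?_ hup
    filter_upwards [eventually_ge_atTop 1] with n hn
    have hn' : (1 : ℝ) ≤ n := by exact_mod_cast hn
    have h8 := (Nat.ceil_lt_add_one (by positivity : 0 ≤ 8 * (Real.log n ^ 2 * n))).le
    rw [div_le_iff₀ (by positivity)]
    calc (m n : ℝ) ≤ 8 * (Real.log n ^ 2 * n) + 1 := h8
      _ ≤ 8 * (Real.log n ^ 2 * n) + n := by linarith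
      _ = _ := by field_simp
  -- With this ε, (1 − ε)/(2α) is exactly the bound of `le_dim_of_no_empty_box`.
  refine ⟨fun n => 1 - (1 - m n / (n : ℝ) ^ 2) * (alpha (c n) * n / s n), ?_, ?_⟩
  · have h1 := (hmn.const_sub 1).mul (hratio.inv₀ one_ne_zero)
    have h2 := h1.const_sub 1
    simp only [sub_zero, inv_one, mul_one, sub_self, inv_div] at h2
    exact h2
  · have hf : Tendsto (fun n : ℕ => √(Real.log n ^ 4 / n) + (1 / 2 : ℝ) ^ n) atTop (𝓝 0) := by
      have h1 := (tendsto_log_pow_div 4).sqrt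
      have h2 := tendsto_pow_atTop_nhds_zero_of_lt_one (by norm_num : (0 : ℝ) ≤ 1 / 2)
        (by norm_num)
      simpa using h1.add h2
    refine aas_of_prob_compl_le hf ?_
    filter_upwards [hbasic] with n ⟨hn, h1, h2, h3, h4, h5, h6⟩
    have hn0 : 0 < n := by exact_mod_cast hn
    have h7 : 0 ≤ η n := by positivity
    have hs0 : 0 < s n := Nat.ceil_pos.2 (by positivity)
    have hs0' : (0 : ℝ) < s n := by exact_mod_cast hs0
    have hm1 : n ≤ m n := by
      have : (n : ℝ) ≤ m n := by
        refine le_trans ?_ (Nat.le_ceil _)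
        nlinarith
      exact_mod_cast this
    have hsub : {E | (1 - (1 - (1 - m n / (n : ℝ) ^ 2) * (alpha (c n) * n / s n))) *
        (1 / (2 * alpha (c n))) ≤ (dim (bipartiteOrder E) : ℝ)}ᶜ ⊆
        {E | ∃ X Y : Finset (Fin n), X.card = s n ∧ Y.card = s n ∧
          ∀ a ∈ X, ∀ b ∈ Y, (a, b) ∉ E} ∪ {E | m n ≤ E.ncard} := by
      intro E hE
      by_contra hcon
      rw [Set.mem_union, not_or] at hcon
      refine hE ?_
      refine le_trans (le_of_eq ?_) (le_dim_of_no_empty_box hn0 hs0 hcon.1 hcon.2)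
      rw [sub_sub_cancel]
      field_simp
    refine (measureReal_mono hsub (measure_ne_top _ _)).trans
      ((measureReal_union_le _ _).trans (add_le_add ?_ ?_))
    · refine (prob_exists_empty_box _ _).trans ((empty_box_bound hn0 (by linarith) h3 (p n).2.2 h7
        hs0 (Nat.le_ceil _)).trans ?_)
      have hsn : (n : ℝ) / Real.log n ^ 2 ≤ s n := by
        have : (n : ℝ) / Real.log n ^ 2 ≤ alpha (c n) * n := by
          rw [div_le_div_iff₀ (by positivity) hn, one_mul] at h6
          rw [div_le_iff₀ (by positivity)]
          nlinarith
        refine this.trans (le_trans ?_ (Nat.le_ceil _))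
        have : 0 < alpha (c n) * n := by positivity
        nlinarith
      have hsq : √(n : ℝ) ^ 2 = n := Real.sq_sqrt hn.le
      have hsq0 : 0 < √(n : ℝ) := Real.sqrt_pos.2 hn
      have h8 : √(n : ℝ) / Real.log n ^ 2 ≤ s n * η n := by
        calc √(n : ℝ) / Real.log n ^ 2 = n / Real.log n ^ 2 * (1 / √n) := by
              rw [← hsq, Real.sqrt_sq hsq0.le]
              field_simp
          _ ≤ s n * η n := by simp only [η]; gcongr
      have h9 : √(Real.log n ^ 4 / n) = 1 / (√(n : ℝ) / Real.log n ^ 2) := by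
        rw [Real.sqrt_div' _ hn.le, one_div_div]
        congr 1
        rw [show Real.log n ^ 4 = (Real.log n ^ 2) ^ 2 by ring, Real.sqrt_sq (by positivity)]
      rw [h9]
      refine one_div_le_one_div_of_le (by positivity) ?_
      linarith
    · refine (prob_many_edges_le (p n) hn0 h3 ?_ (by omega)).trans
        (pow_le_pow_of_le_one (by norm_num) (by norm_num) hm1)
      refine le_trans ?_ (Nat.le_ceil _)
      gcongr

theorem aas_log_le_dim {c : ℕ → ℝ} {p : ℕ → unitInterval}
    (h : ∀ᶠ n : ℕ in atTop, 2 ≤ c n ∧ c n ≤ (Real.log n) ^ 2 ∧ (p n : ℝ) = c n / n) :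
    AAS p (fun n => {E | 1 / 16 * (c n / Real.log (c n)) ≤ (dim (bipartiteOrder E) : ℝ)}) := by
  obtain ⟨ε, hε, hS⟩ := exists_aas_le_dim c p h
  -- Serves as monotonicity of a.a.s. events. The constant 1/16 is 1/2 from ε ≤ 1/2 times 1/8 from
  -- α_c ≤ 4 log c / c.
  refine hS.and hS ?_
  filter_upwards [h, hε.eventually_le_const (by norm_num : (0 : ℝ) < 1 / 2)] with n hn hεn
  rintro E ⟨hE, -⟩
  refine le_trans ?_ (Set.mem_ofPred_eq.mp hE)
  have hc : 0 < c n := by linarith [hn.1]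
  have hlog : 0 < Real.log (c n) := Real.log_pos (by linarith [hn.1])
  have hα := (alpha_spec hc).1
  have h1 : c n / Real.log (c n) / 8 ≤ 1 / (2 * alpha (c n)) := by
    rw [div_div, div_le_div_iff₀ (by positivity) (by positivity)]
    have := alpha_le_log_div hn.1
    rw [le_div_iff₀ hc] at this
    linarith
  have h2 : 0 ≤ 1 / (2 * alpha (c n)) := by positivity
  nlinarith

/-! ### The upper bound. -/

/-- The number of random sets of colours used for an average degree at most `C`. -/
noncomputable def topSetCount (C : ℕ) : ℕ := ⌈Real.exp 1 * (32 * C + 1) * (46 * Real.log C)⌉₊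

/-- Parameters: degree cap 32C and C^29 colours. Injectivity fails at rate 1024C²/C^29 ≤ C^{-17}
because 1024 ≤ C^10; isolation fails at rate C^29 · C^{-46}, which explains 46 = 29 + 17. -/
theorem failure_rate_le {C : ℕ} (hC : 2 ≤ C) :
    (((32 * C : ℕ) : ℝ) ^ 2 / (C ^ 29 : ℕ) + (C ^ 29 : ℕ) *
      (1 - 1 / (Real.exp 1 * ((32 * C : ℕ) + 1))) ^ topSetCount C) ≤ 2 / C ^ 17 := by
  have hC' : (2 : ℝ) ≤ C := by exact_mod_cast hC
  have hC0 : (0 : ℝ) < C := by linarith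
  have h1 : ((32 * C : ℕ) : ℝ) ^ 2 / (C ^ 29 : ℕ) ≤ 1 / C ^ 17 := by
    push_cast
    rw [div_le_div_iff₀ (by positivity) (by positivity)]
    have : (1024 : ℝ) ≤ C ^ 10 := by
      calc (1024 : ℝ) = 2 ^ 10 := by norm_num
        _ ≤ C ^ 10 := by gcongr
    calc (32 * (C : ℝ)) ^ 2 * (C : ℝ) ^ 17 = 1024 * (C : ℝ) ^ 19 := by ring
      _ ≤ (C : ℝ) ^ 10 * C ^ 19 := by gcongr
      _ = 1 * (C : ℝ) ^ 29 := by ring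
  have h2 : (1 - 1 / (Real.exp 1 * (((32 * C : ℕ) : ℝ) + 1))) ^ topSetCount C ≤ 1 / C ^ 46 := by
    set z := Real.exp 1 * (((32 * C : ℕ) : ℝ) + 1) with hz
    have hz0 : 0 < z := by positivity
    have hz1 : 1 ≤ z := by
      have := Real.add_one_le_exp 1
      have : (0 : ℝ) ≤ ((32 * C : ℕ) : ℝ) := by positivity
      nlinarith
    have hk : z * (46 * Real.log C) ≤ topSetCount C := by
      rw [topSetCount, hz]
      push_cast
      exact Nat.le_ceil _
    calc (1 - 1 / z) ^ topSetCount C ≤ (Real.exp (-(1 / z))) ^ topSetCount C := by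
          have := Real.add_one_le_exp (-(1 / z))
          have h0 : 1 / z ≤ 1 := by rw [div_le_one hz0]; exact hz1
          exact pow_le_pow_left₀ (by linarith) (by linarith) _
      _ = Real.exp (-(topSetCount C / z)) := by
          rw [← Real.exp_nat_mul]
          congr 1
          ring
      _ ≤ Real.exp (-(46 * Real.log C)) := by
          rw [Real.exp_le_exp, neg_le_neg_iff, le_div_iff₀ hz0]
          linarith
      _ = 1 / C ^ 46 := by
          rw [Real.exp_neg, mul_comm, Real.exp_mul, Real.exp_log hC0, one_div]
          norm_cast
  calc _ ≤ 1 / (C : ℝ) ^ 17 + C ^ 29 * (1 / C ^ 46) := by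
        have h3 : (((C ^ 29 : ℕ) : ℝ)) = (C : ℝ) ^ 29 := by push_cast; rfl
        rw [h3] at h1 ⊢
        gcongr
    _ = 2 / C ^ 17 := by
        field_simp
        norm_num

/-- A bipartite graph with few edges between small sets and few vertices of large degree has small
dimension. -/
theorem dim_le_of_sparse {n C : ℕ} (hC : 2 ≤ C) {E : Set (Fin n × Fin n)}
    (hdeg : ¬ ∃ X Y : Finset (Fin n), X.card = n ∧ Y.card = ⌈(n : ℝ) / C ^ 17⌉₊ ∧
      32 * C * ⌈(n : ℝ) / C ^ 17⌉₊ ≤ edgeCount E X Y)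
    (hsparse : ¬ ∃ X Y : Finset (Fin n), Y.card ≤ n / C ^ 15 ∧
      3 * (X.card + Y.card) < 2 * edgeCount E X Y) :
    dim (bipartiteOrder E) ≤ 2 * topSetCount C + 1528 := by
  classical
  have hC' : (2 : ℝ) ≤ C := by exact_mod_cast hC
  have hC0 : (0 : ℝ) < C := by linarith
  set y := ⌈(n : ℝ) / C ^ 17⌉₊ with hy
  let S : Finset (Fin n) := Finset.univ.filter fun b => (nbrs E b).card ≤ 32 * C
  obtain ⟨T, ω, Z, hZS, hsep, hZ⟩ := exists_mostly_separates (nbrs E) S (32 * C) (C ^ 29)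
    (topSetCount C) (by omega) (by positivity) (fun b hb => (Finset.mem_filter.1 hb).2)
  have hhigh : Sᶜ.card < y := by
    by_contra! hlt
    obtain ⟨Y, hYS, hY⟩ := Finset.exists_subset_card_eq hlt
    refine hdeg ⟨Finset.univ, Y, by simp, hY, ?_⟩
    rw [← sum_card_nbrs_inter, ← hY, mul_comm, ← smul_eq_mul, ← Finset.sum_const]
    refine Finset.sum_le_sum fun b hb => ?_
    have : b ∉ S := Finset.mem_compl.1 (hYS hb)
    simp only [S, Finset.mem_filter, Finset.mem_univ, true_and, not_le] at this
    simpa using this.le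
  have hhigh' : (Sᶜ.card : ℝ) ≤ n / C ^ 17 := (Nat.lt_ceil.1 hhigh).le
  have hScard : (S.card : ℝ) ≤ n := by
    have := Finset.card_le_univ S
    rw [Fintype.card_fin] at this
    exact_mod_cast this
  have hn0 : (0 : ℝ) ≤ n := n.cast_nonneg
  have hrate : 0 ≤ ((32 * C : ℕ) : ℝ) ^ 2 / (C ^ 29 : ℕ) + (C ^ 29 : ℕ) *
      (1 - 1 / (Real.exp 1 * ((32 * C : ℕ) + 1))) ^ topSetCount C := by
    have : 0 ≤ 1 - 1 / (Real.exp 1 * (((32 * C : ℕ) : ℝ) + 1)) := by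
      have := Real.add_one_le_exp 1
      have : (0 : ℝ) ≤ ((32 * C : ℕ) : ℝ) := by positivity
      rw [sub_nonneg, div_le_one (by positivity)]
      nlinarith
    positivity
  have hZ' : ((S.card - Z.card : ℕ) : ℝ) ≤ 2 * (n / C ^ 17) := by
    refine hZ.trans ?_
    calc _ ≤ (n : ℝ) * (2 / C ^ 17) := by
          exact mul_le_mul hScard (failure_rate_le hC) hrate hn0
      _ = _ := by ring
  -- At most n/C^17 vertices of high degree and 2n/C^17 failures, and 3 ≤ C².
  have hsmall : Zᶜ.card ≤ n / C ^ 15 := by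
    have h1 : Zᶜ.card = Sᶜ.card + (S.card - Z.card) := by
      have h2 := Finset.card_le_card hZS
      have h3 := Finset.card_add_card_compl S
      have h4 := Finset.card_add_card_compl Z
      omega
    rw [Nat.le_div_iff_mul_le (by positivity)]
    have h2 : (Zᶜ.card : ℝ) ≤ 3 * (n / C ^ 17) := by
      rw [h1]
      push_cast
      linarith
    have h3 : (Zᶜ.card : ℝ) * C ^ 15 ≤ n := by
      calc (Zᶜ.card : ℝ) * (C : ℝ) ^ 15 ≤ 3 * (n / C ^ 17) * (C : ℝ) ^ 15 := by gcongr
        _ = (n : ℝ) * (3 / (C : ℝ) ^ 2) := by field_simp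
        _ ≤ (n : ℝ) * 1 := by
          gcongr
          rw [div_le_one (by positivity)]
          nlinarith
        _ = n := mul_one _
    exact_mod_cast h3
  have hsp : IsSparse (nbrs E) Zᶜ := by
    intro X Y hY
    rw [sum_card_nbrs_inter]
    by_contra! hlt
    exact hsparse ⟨X, Y, (Finset.card_le_card hY).trans hsmall, hlt⟩
  obtain ⟨T', ω', hsep'⟩ := hsp.exists_separates
  have := dim_le_of_separates E hsep hsep' (fun b => by
    by_cases hb : b ∈ Z
    · exact Or.inl (Finset.mem_coe.2 hb)
    · exact Or.inr (Finset.mem_coe.2 (Finset.mem_compl.2 hb)))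
  simp only [Fintype.card_prod, Fintype.card_fin] at this
  omega

/-- y vertices of B receive at most Cy edges on average, so 32Cy edges cost (e/32)^{32Cy} ≤
8^{-32Cy}, which beats the (4C^17)^y choices of Y. -/
theorem prob_many_high_degree_le {n C : ℕ} (hn : 0 < n) (hC : 2 ≤ C) (p : unitInterval)
    (hp : (p : ℝ) * n ≤ C) :
    (randomBipartite n p).real {E | ∃ X Y : Finset (Fin n), X.card = n ∧
      Y.card = ⌈(n : ℝ) / C ^ 17⌉₊ ∧ 32 * C * ⌈(n : ℝ) / C ^ 17⌉₊ ≤ edgeCount E X Y} ≤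
      (C : ℝ) ^ 17 / n := by
  have hn' : (0 : ℝ) < n := by exact_mod_cast hn
  have hC' : (2 : ℝ) ≤ C := by exact_mod_cast hC
  have hC0 : (0 : ℝ) < C := by linarith
  have hp0 : 0 ≤ (p : ℝ) := p.2.1
  set y := ⌈(n : ℝ) / C ^ 17⌉₊ with hy
  have hy1 : (n : ℝ) / C ^ 17 ≤ y := Nat.le_ceil _
  have hy0 : 0 < y := Nat.ceil_pos.2 (by positivity)
  have hy0' : (0 : ℝ) < y := by exact_mod_cast hy0
  have he : Real.exp 1 ≤ 4 := by linarith [Real.exp_one_lt_d9]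
  have h1 : (n.choose y : ℝ) ≤ (4 * (C : ℝ) ^ 17) ^ y := by
    refine (choose_le_exp_mul_div_pow n y).trans (pow_le_pow_left₀ (by positivity) ?_ y)
    rw [mul_div_assoc]
    have : (n : ℝ) / y ≤ C ^ 17 := by
      rw [div_le_iff₀ (by positivity)] at hy1 ⊢
      linarith
    gcongr
  have h2 : ((n * y).choose (32 * C * y) : ℝ) * (p : ℝ) ^ (32 * C * y) ≤
      ((1 / 8) ^ (32 * C)) ^ y := by
    rw [← pow_mul]
    refine (choose_mul_pow_le _ _ hp0).trans (pow_le_pow_left₀ (by positivity) ?_ _)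
    push_cast
    rw [div_le_iff₀ (by positivity)]
    calc Real.exp 1 * (n * y) * p = Real.exp 1 * (p * n) * y := by ring
      _ ≤ 4 * C * y := by gcongr
      _ = 1 / 8 * (32 * C * y) := by ring
  have h3 : 4 * (C : ℝ) ^ 17 * (1 / 8) ^ (32 * C) ≤ 1 / 2 := by
    have h4 : (C : ℝ) ≤ 2 ^ C := by exact_mod_cast (Nat.lt_two_pow_self (n := C)).le
    have h5 : (4 : ℝ) ≤ 2 ^ C := by
      calc (4 : ℝ) = 2 ^ 2 := by norm_num
        _ ≤ 2 ^ C := by gcongr; norm_num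
    calc 4 * (C : ℝ) ^ 17 * (1 / 8) ^ (32 * C)
        ≤ 2 ^ C * (2 ^ C) ^ 17 * (1 / 8) ^ (32 * C) := by gcongr
      _ = (1 / 2) ^ (78 * C) := by
          rw [show (1 / 8 : ℝ) = (1 / 2) ^ 3 by norm_num, ← pow_succ', ← pow_mul, ← pow_mul,
            show 3 * (32 * C) = C * 18 + 78 * C by ring, pow_add, ← mul_assoc, ← mul_pow]
          norm_num
      _ ≤ (1 / 2) ^ 1 := pow_le_pow_of_le_one (by norm_num) (by norm_num) (by omega)
      _ = 1 / 2 := pow_one _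
  refine (prob_exists_le_edgeCount p n y (32 * C * y)).trans ?_
  rw [Nat.choose_self, Nat.cast_one, one_mul]
  calc (n.choose y : ℝ) * (((n * y).choose (32 * C * y) : ℝ) * (p : ℝ) ^ (32 * C * y))
      ≤ (4 * (C : ℝ) ^ 17) ^ y * ((1 / 8) ^ (32 * C)) ^ y := by gcongr
    _ = (4 * (C : ℝ) ^ 17 * (1 / 8) ^ (32 * C)) ^ y := (mul_pow _ _ _).symm
    _ ≤ (1 / 2) ^ y := by gcongr
    _ ≤ 1 / y := by
        rw [div_pow, one_pow]
        refine one_div_le_one_div_of_le hy0' ?_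
        exact_mod_cast (Nat.lt_two_pow_self (n := y)).le
    _ ≤ 1 / (n / C ^ 17) := one_div_le_one_div_of_le (by positivity) hy1
    _ = _ := one_div_div _ _

/-- The construction uses only O(c log c) orders; since log c ≥ log 2, a further factor log c is
given away and absorbs the additive constants. -/
theorem topSetCount_bound {c : ℝ} (hc : 2 ≤ c) :
    ((2 * topSetCount ⌈c⌉₊ + 1528 : ℕ) : ℝ) ≤ 100000 * (c * Real.log c ^ 2) := by
  have hc0 : 0 < c := by linarith
  set C := ⌈c⌉₊ with hCdef
  have h1 : c ≤ C := Nat.le_ceil _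
  have h2 : (C : ℝ) ≤ 2 * c := by linarith [Nat.ceil_lt_add_one hc0.le]
  have hlog : 0.6931471803 < Real.log c :=
    Real.log_two_gt_d9.trans_le (Real.log_le_log (by norm_num) hc)
  have hlogC : Real.log C ≤ 2 * Real.log c := by
    calc Real.log C ≤ Real.log (c ^ 2) := Real.log_le_log (by linarith) (by nlinarith)
      _ = 2 * Real.log c := by rw [Real.log_pow]; norm_num
  have hlogC0 : 0 ≤ Real.log C := Real.log_nonneg (by linarith)
  have he := Real.exp_one_lt_d9
  have hk : (topSetCount C : ℝ) ≤ 2.72 * (66 * c) * (46 * (2 * Real.log c)) + 1 := by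
    have h3 := (Nat.ceil_lt_add_one
      (by positivity : 0 ≤ Real.exp 1 * (32 * C + 1) * (46 * Real.log C))).le
    refine h3.trans ?_
    gcongr
    · linarith
    · linarith
  push_cast
  have h5 : 1.38 ≤ c * Real.log c := by nlinarith
  have h6 : 0.69 * (c * Real.log c) ≤ c * Real.log c ^ 2 := by nlinarith
  nlinarith

theorem aas_dim_le {c : ℕ → ℝ} {p : ℕ → unitInterval}
    (h : ∀ᶠ n : ℕ in atTop, 2 ≤ c n ∧ c n ≤ (Real.log n) ^ 2 ∧ (p n : ℝ) = c n / n) :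
    AAS p (fun n => {E |
      (dim (bipartiteOrder E) : ℝ) ≤ 100000 * (c n * Real.log (c n) ^ 2)}) := by
  have hf : Tendsto (fun n : ℕ => 2 ^ 17 * (Real.log n ^ 34 / n) +
      4096 * (Real.exp 1 ^ 5 * 2 ^ 3) ^ 3 * (Real.log n ^ 18 / n)) atTop (𝓝 0) := by
    have := ((tendsto_log_pow_div 34).const_mul (2 ^ 17)).add
      ((tendsto_log_pow_div 18).const_mul (4096 * (Real.exp 1 ^ 5 * 2 ^ 3) ^ 3))
    rwa [mul_zero, mul_zero, add_zero] at this
  refine aas_of_prob_compl_le hf ?_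
  filter_upwards [h, eventually_gt_atTop 0] with n ⟨h2, hlog, hp⟩ hn
  have hn' : (0 : ℝ) < n := by exact_mod_cast hn
  set C := ⌈c n⌉₊ with hCdef
  have hcC : c n ≤ C := Nat.le_ceil _
  have hC2 : 2 ≤ C := by exact_mod_cast h2.trans hcC
  have hC2' : (2 : ℝ) ≤ C := by exact_mod_cast hC2
  have hClog : (C : ℝ) ≤ 2 * Real.log n ^ 2 := by
    linarith [Nat.ceil_lt_add_one (by linarith : 0 ≤ c n)]
  have hpC : (p n : ℝ) * n ≤ C := by
    rw [hp, div_mul_cancel₀ _ hn'.ne']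
    exact hcC
  -- The exponent 15 is 12 + 3: C^12 ≥ 16e^5 and C^3 comes from the sparsity bound.
  have hM : 16 * (Real.exp 1 ^ 5 * (C : ℝ) ^ 3) * ((n / C ^ 15 : ℕ) : ℝ) ≤ n := by
    have h3 : ((n / C ^ 15 : ℕ) : ℝ) ≤ n / C ^ 15 := by
      have := Nat.cast_div_le (α := ℝ) (m := n) (n := C ^ 15)
      push_cast at this
      exact this
    have h4 : 16 * Real.exp 1 ^ 5 ≤ (C : ℝ) ^ 12 := by
      calc 16 * Real.exp 1 ^ 5 ≤ 16 * 2.72 ^ 5 := by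
            gcongr
            linarith [Real.exp_one_lt_d9]
        _ ≤ 2 ^ 12 := by norm_num
        _ ≤ (C : ℝ) ^ 12 := by gcongr
    calc 16 * (Real.exp 1 ^ 5 * (C : ℝ) ^ 3) * ((n / C ^ 15 : ℕ) : ℝ)
        ≤ 16 * (Real.exp 1 ^ 5 * (C : ℝ) ^ 3) * (n / C ^ 15) := by gcongr
      _ = 16 * Real.exp 1 ^ 5 * (C : ℝ) ^ 3 * (n / C ^ 15) := by ring
      _ ≤ (C : ℝ) ^ 12 * (C : ℝ) ^ 3 * (n / C ^ 15) := by gcongr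
      _ = n := by field_simp
  have hsub : {E | (dim (bipartiteOrder E) : ℝ) ≤ 100000 * (c n * Real.log (c n) ^ 2)}ᶜ ⊆
      {E | ∃ X Y : Finset (Fin n), X.card = n ∧ Y.card = ⌈(n : ℝ) / C ^ 17⌉₊ ∧
        32 * C * ⌈(n : ℝ) / C ^ 17⌉₊ ≤ edgeCount E X Y} ∪
      {E | ∃ X Y : Finset (Fin n), Y.card ≤ n / C ^ 15 ∧
        3 * (X.card + Y.card) < 2 * edgeCount E X Y} := by
    intro E hE
    by_contra hcon
    rw [Set.mem_union, not_or] at hcon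
    refine hE (le_trans ?_ (topSetCount_bound h2))
    exact_mod_cast dim_le_of_sparse hC2 hcon.1 hcon.2
  refine (measureReal_mono hsub (measure_ne_top _ _)).trans
    ((measureReal_union_le _ _).trans (add_le_add ?_ ?_))
  · refine (prob_many_high_degree_le hn hC2 (p n) hpC).trans ?_
    calc (C : ℝ) ^ 17 / n ≤ (2 * Real.log n ^ 2) ^ 17 / n := by gcongr
      _ = _ := by ring
  · refine (prob_exists_dense_le (p n) (by linarith) hpC hM).trans ?_
    calc 4096 * (Real.exp 1 ^ 5 * (C : ℝ) ^ 3) ^ 3 / n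
        ≤ 4096 * (Real.exp 1 ^ 5 * (2 * Real.log n ^ 2) ^ 3) ^ 3 / n := by gcongr
      _ = _ := by ring

end RandomBipartiteOrder

theorem theorem2p5 :
    (∀ (c : ℕ → ℝ) (p : ℕ → unitInterval),
      (∀ᶠ n : ℕ in atTop, 2 ≤ c n ∧ c n ≤ (Real.log n) ^ 2 ∧ (p n : ℝ) = c n / n) →
      ∃ ε : ℕ → ℝ, Tendsto ε atTop (𝓝 0) ∧
        RandomBipartiteOrder.AAS p (fun n => {E |
          (1 - ε n) * (1 / (2 * RandomBipartiteOrder.alpha (c n))) ≤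
            (RandomBipartiteOrder.dim (RandomBipartiteOrder.bipartiteOrder E) : ℝ)})) ∧
    (∃ γ₁ γ₂ : ℝ, 0 < γ₁ ∧ 0 < γ₂ ∧
      ∀ (c : ℕ → ℝ) (p : ℕ → unitInterval),
        (∀ᶠ n : ℕ in atTop, 2 ≤ c n ∧ c n ≤ (Real.log n) ^ 2 ∧ (p n : ℝ) = c n / n) →
        RandomBipartiteOrder.AAS p (fun n => {E |
          γ₁ * (c n / Real.log (c n)) ≤
            (RandomBipartiteOrder.dim (RandomBipartiteOrder.bipartiteOrder E) : ℝ) ∧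
          (RandomBipartiteOrder.dim (RandomBipartiteOrder.bipartiteOrder E) : ℝ) ≤
            γ₂ * (c n * (Real.log (c n)) ^ 2)})) :=
  ⟨RandomBipartiteOrder.exists_aas_le_dim, 1 / 16, 100000, by norm_num, by norm_num,
    fun _ _ h => (RandomBipartiteOrder.aas_log_le_dim h).and (RandomBipartiteOrder.aas_dim_le h)
      (Eventually.of_forall fun _ _ hE => hE)⟩
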